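/- Let $K$ be a field, $\Gamma$ a finite quiver, $R=K\Gamma$ its path algebra (paths are composed from left to right), $J$ the ideal of $R$ generated by the arrows, and $I\subseteq J^2$ a two-sided ideal generated by elements that are homogeneous for the length grading. Let $\Lambda=R/I$ with the induced grading, and $\Lambda_0=\Lambda/(J/I)$, a graded left $\Lambda$-module concentrated in degree $0$. Fix an admissible order $>$ on the set of paths of $\Gamma$ (a well-order such that $p>q$ implies $rp>rq$ and $pr>qr$ whenever both products are nonzero, and $p\ge r$ whenever $r$ is a subpath of $p$), let $\operatorname{tip}(x)$ be the largest path occurring in $x\in R\setminus\{0\}$, let $\mathcal G$ be the reduced Gröbner basis of $I$ with respect to $>$, and let $\Lambda_{mon}=R/I_{mon}$, where $I_{mon}$ is the ideal generated by $\{\operatorname{tip}(g): g\in\mathcal G\}$. A minimal graded projective resolution of $\Lambda_0$ is an exact sequence $\cdots\to P^2\to P^1\to P^0\to\Lambda_0\to0$ of graded left $\Lambda$-modules and degree-$0$ maps with every $P^n$ projective and $\operatorname{im}(P^n\to P^{n-1})\subseteq (J/I)P^{n-1}$ for $n\ge1$. For $F\colon\mathbb N\to\mathbb N$, the algebra $\Lambda$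 is called $F$-determined if, for every $n\ge 0$, the module $P^n$ of a minimal graded projective resolution of $\Lambda_0$ can be generated in degree $F(n)$; the same definition is used for $\Lambda_{mon}$. The Anick–Green–Solberg (AGS) resolution of $\Lambda_0$ is the complex $\cdots\to Q^2\to Q^1\to Q^0$ with $Q^n=\bigoplus_i Rf^n_i\big/\bigoplus_i If^n_i$ and with differentials induced by the inclusions $\bigoplus_i Rf^{n}_i\subseteq\bigoplus_j Rf^{n-1}_j$, where $f^0$ is the set of vertices, $f^1$ the set of arrows and, for $n\ge2$, $f^n$ consists of the elements of the reduced left Gröbner basis of the left ideal $\big(\bigoplus_i Rf^{n-1}_i\big)\cap\big(\bigoplus_i If^{n-2}_i\big)$ whose tips are not tips of elements of $\bigoplus_i If^{n-1}_i$. It is called minimal if $\operatorname{im}(Q^n\to Q^{n-1})\subseteq (J/I)Q^{n-1}$ for all $n\ge1$. Let $F\colon\mathbb N\to\mathbb N$ be a function such that $\Lambda$ is $F$-determined, and assume that the AGS resolution of $\Lambda_0$ is minimal. Then $\Lambda_{mon}$ is $F$-determined. -/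

import Mathlib

universe u v w

noncomputable section

/-- A path of the quiver `V`, with its endpoints; the empty path at `a` is the vertex `a`. -/
def QPath (V : Type u) [Quiver.{v} V] : Type (max u v) :=
  Σ a b : V, Quiver.Path a b

namespace QPath

variable {V : Type u} [Quiver.{v} V]

/-- The vertex at which a path starts. -/
def source (p : QPath V) : V := p.1

/-- The vertex at which a path ends. -/
def target (p : QPath V) : V := p.2.1

/-- The number of arrows of a path. -/
def length (p : QPath V) : ℕ := p.2.2.length

/-- A vertex as a path of length `0`. -/
def vertex (a : V) : QPath V := ⟨a, a, Quiver.Path.nil⟩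

/-- An arrow as a path of length `1`. -/
def arrow {a b : V} (e : a ⟶ b) : QPath V := ⟨a, b, e.toPath⟩

open Classical in
/-- Concatenation `pq` of paths (first `p`, then `q`), read from left to right;
`none` if `p` does not end where `q` starts. -/
def concat (p q : QPath V) : Option (QPath V) :=
  if h : q.1 = p.2.1 then some ⟨p.1, q.2.1, p.2.2.comp (q.2.2.cast h rfl)⟩ else none

/-- `t` is a subpath of `p`: `p = r t s` for some paths `r` and `s`, possibly of length `0`. -/
def IsSubpath (t p : QPath V) : Prop :=
  ∃ r s rt : QPath V, concat r t = some rt ∧ concat rt s = some p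

/-- `t` is a terminal subpath of `p`: `p = r t` for some path `r`, possibly of length `0`. -/
def IsSuffix (t p : QPath V) : Prop :=
  ∃ r : QPath V, concat r t = some p

theorem concat_mk {a b c : V} (p : Quiver.Path a b) (q : Quiver.Path b c) :
    concat (⟨a, b, p⟩ : QPath V) ⟨b, c, q⟩ = some ⟨a, c, p.comp q⟩ := by
  simp [concat]

theorem concat_eq_none {p q : QPath V} (h : q.1 ≠ p.2.1) : concat p q = none := by
  simp [concat, h]

theorem concat_assoc (p q r : QPath V) :
    (concat p q).bind (fun x => concat x r) = (concat q r).bind (fun x => concat p x) := by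
  obtain ⟨a, b, p⟩ := p
  obtain ⟨c, d, q⟩ := q
  obtain ⟨e, f, r⟩ := r
  by_cases h₁ : c = b
  · subst h₁
    rw [concat_mk]
    by_cases h₂ : e = d
    · subst h₂
      rw [concat_mk]
      erw [Option.bind_some, Option.bind_some]
      rw [concat_mk, concat_mk, Quiver.Path.comp_assoc]
    · rw [concat_eq_none (p := ⟨_, _, q⟩) (q := ⟨_, _, r⟩) h₂]
      erw [Option.bind_some]
      exact concat_eq_none (p := ⟨_, _, p.comp q⟩) (q := ⟨_, _, r⟩) h₂
  · rw [concat_eq_none (p := ⟨_, _, p⟩) (q := ⟨_, _, q⟩) h₁]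
    by_cases h₂ : e = d
    · subst h₂
      rw [concat_mk]
      erw [Option.bind_some]
      exact (concat_eq_none (p := ⟨_, _, p⟩) (q := ⟨_, _, q.comp r⟩) h₁).symm
    · rw [concat_eq_none (p := ⟨_, _, q⟩) (q := ⟨_, _, r⟩) h₂]
      rfl

theorem concat_vertex (p : QPath V) (a : V) [Decidable (a = p.2.1)] :
    concat p (vertex a) = if a = p.2.1 then some p else none := by
  obtain ⟨c, b, p⟩ := p
  split_ifs with h
  · obtain rfl : a = b := h
    exact concat_mk p Quiver.Path.nil
  · exact concat_eq_none h

theorem vertex_concat (p : QPath V) (a : V) [Decidable (a = p.1)] :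
    concat (vertex a) p = if a = p.1 then some p else none := by
  obtain ⟨c, b, p⟩ := p
  split_ifs with h
  · obtain rfl : a = c := h
    simp [vertex, concat_mk]
  · exact concat_eq_none (fun h' => h h'.symm)

end QPath

/-- The product of two paths as a formal linear combination of paths: their concatenation, or `0`. -/
def pathMul (K : Type w) [Field K] {V : Type u} [Quiver.{v} V] (p q : QPath V) : QPath V →₀ K :=
  (p.concat q).elim 0 (fun x => Finsupp.single x 1)

/-- The bilinear extension of the product of paths. -/
def pathMulMap (K : Type w) [Field K] (V : Type u) [Quiver.{v} V] :
    (QPath V →₀ K) →ₗ[K] (QPath V →₀ K) →ₗ[K] (QPath V →₀ K) :=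
  Finsupp.lift ((QPath V →₀ K) →ₗ[K] (QPath V →₀ K)) K (QPath V)
    (fun p => Finsupp.lift (QPath V →₀ K) K (QPath V) (fun q => pathMul K p q))

section mulFacts

variable {K : Type w} [Field K] {V : Type u} [Quiver.{v} V]

theorem pathMulMap_single (p q : QPath V) :
    pathMulMap K V (Finsupp.single p 1) (Finsupp.single q 1) = pathMul K p q := by
  simp [pathMulMap]

theorem pathMulMap_elim_left (o : Option (QPath V)) (r : QPath V) :
    pathMulMap K V (o.elim 0 (fun x => Finsupp.single x 1)) (Finsupp.single r 1)
      = (o.bind (fun x => x.concat r)).elim 0 (fun x => Finsupp.single x 1) := by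
  cases o with
  | none => simp
  | some x => simp only [Option.elim_some, Option.bind_some, pathMulMap_single, pathMul]

theorem pathMulMap_elim_right (o : Option (QPath V)) (p : QPath V) :
    pathMulMap K V (Finsupp.single p 1) (o.elim 0 (fun x => Finsupp.single x 1))
      = (o.bind (fun x => p.concat x)).elim 0 (fun x => Finsupp.single x 1) := by
  cases o with
  | none => simp
  | some x => simp only [Option.elim_some, Option.bind_some, pathMulMap_single, pathMul]

theorem pathMulMap_assoc (x y z : QPath V →₀ K) :
    pathMulMap K V (pathMulMap K V x y) z = pathMulMap K V x (pathMulMap K V y z) := by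
  induction x using Finsupp.induction_linear with
  | zero => simp
  | add x x' hx hx' => simp only [map_add, LinearMap.add_apply, hx, hx']
  | single p a =>
    induction y using Finsupp.induction_linear with
    | zero => simp
    | add y y' hy hy' => simp only [map_add, LinearMap.add_apply, hy, hy']
    | single q b =>
      induction z using Finsupp.induction_linear with
      | zero => simp
      | add z z' hz hz' => simp only [map_add, hz, hz']
      | single r c =>
        rw [← mul_one a, ← mul_one b, ← mul_one c, ← smul_eq_mul a, ← smul_eq_mul b,
          ← smul_eq_mul c, ← Finsupp.smul_single, ← Finsupp.smul_single, ← Finsupp.smul_single]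
        simp only [map_smul, LinearMap.smul_apply]
        rw [pathMulMap_single, pathMulMap_single, pathMul, pathMul, pathMulMap_elim_left,
          pathMulMap_elim_right, QPath.concat_assoc]

theorem pathMulMap_one [Fintype V] (x : QPath V →₀ K) :
    pathMulMap K V x (∑ a : V, Finsupp.single (QPath.vertex a) 1) = x := by
  classical
  induction x using Finsupp.induction_linear with
  | zero => simp
  | add x x' hx hx' => rw [map_add, LinearMap.add_apply, hx, hx']
  | single p c =>
    rw [← mul_one c, ← smul_eq_mul c, ← Finsupp.smul_single, map_smul, LinearMap.smul_apply, map_sum]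
    congr 1
    rw [Finset.sum_eq_single p.2.1]
    · rw [pathMulMap_single, pathMul, QPath.concat_vertex, if_pos rfl]; rfl
    · intro a _ ha
      rw [pathMulMap_single, pathMul, QPath.concat_vertex, if_neg ha]; rfl
    · simp

theorem one_pathMulMap [Fintype V] (x : QPath V →₀ K) :
    pathMulMap K V (∑ a : V, Finsupp.single (QPath.vertex a) 1) x = x := by
  classical
  induction x using Finsupp.induction_linear with
  | zero => simp
  | add x x' hx hx' => rw [map_add, hx, hx']
  | single p c =>
    rw [← mul_one c, ← smul_eq_mul c, ← Finsupp.smul_single, map_smul, map_sum, LinearMap.sum_apply]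
    congr 1
    rw [Finset.sum_eq_single p.1]
    · rw [pathMulMap_single, pathMul, QPath.vertex_concat, if_pos rfl]; rfl
    · intro a _ ha
      rw [pathMulMap_single, pathMul, QPath.vertex_concat, if_neg ha]; rfl
    · simp

end mulFacts

/-- The path algebra of the quiver `V` over `K`: the vector space with basis the set of
paths, whose multiplication is the bilinear extension of concatenation
(the product of two paths that cannot be concatenated is `0`). -/
def PathAlgebra (K : Type w) [Field K] (V : Type u) [Quiver.{v} V] : Type (max u v w) :=
  QPath V →₀ K

namespace PathAlgebra

section ring

variable {K : Type w} [Field K] {V : Type u} [Quiver.{v} V]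

instance : AddCommGroup (PathAlgebra K V) := inferInstanceAs (AddCommGroup (QPath V →₀ K))

instance : Module K (PathAlgebra K V) := inferInstanceAs (Module K (QPath V →₀ K))

/-- The family of coefficients of an element of the path algebra; the path `p` occurs in `x`
if and only if `p ∈ (coeff x).support`. -/
def coeff (x : PathAlgebra K V) : QPath V →₀ K := x

variable (K) in
/-- A path as an element of the path algebra. -/
def ofPath (p : QPath V) : PathAlgebra K V := (Finsupp.single p 1 : QPath V →₀ K)

/-- The path algebra of a quiver with finitely many vertices is a ring; its unit is the sum of
the vertices. -/
instance [Fintype V] : Ring (PathAlgebra K V) :=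
  { (inferInstance : AddCommGroup (PathAlgebra K V)) with
    mul := fun x y => pathMulMap K V x y
    one := (∑ a : V, Finsupp.single (QPath.vertex a) 1 : QPath V →₀ K)
    left_distrib := fun x y z => (pathMulMap K V x).map_add y z
    right_distrib := fun x y z => (pathMulMap K V).map_add₂ x y z
    zero_mul := fun x => (pathMulMap K V).map_zero₂ x
    mul_zero := fun x => (pathMulMap K V x).map_zero
    mul_assoc := pathMulMap_assoc
    one_mul := one_pathMulMap
    mul_one := pathMulMap_one }

end ring

/-! ### Ideals, homogeneous elements, Groebner bases -/

section ideals

variable (K : Type w) [Field K] (V : Type u) [Quiver.{v} V] [Fintype V]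

/-- The vertices, as elements of the path algebra. -/
def vertexSet : Set (PathAlgebra K V) := {x | ∃ a : V, x = ofPath K (QPath.vertex a)}

/-- The arrows, as elements of the path algebra. -/
def arrowSet : Set (PathAlgebra K V) :=
  {x | ∃ (a b : V) (e : a ⟶ b), x = ofPath K (QPath.arrow e)}

variable {K V}

/-- The two-sided ideal generated by a set. -/
def genIdeal (X : Set (PathAlgebra K V)) : Ideal (PathAlgebra K V) :=
  (TwoSidedIdeal.span X).asIdeal

instance (X : Set (PathAlgebra K V)) : (genIdeal X).IsTwoSided :=
  inferInstanceAs ((TwoSidedIdeal.span X).asIdeal.IsTwoSided)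

variable (K V) in
/-- The ideal `J` generated by the arrows. -/
def arrowIdeal : Ideal (PathAlgebra K V) := genIdeal (arrowSet K V)

/-- `x` is homogeneous of degree `n` for the length grading: all paths occurring in `x` have
length `n` (so `0` is homogeneous of every degree). -/
def IsHomogeneousOfDegree (n : ℕ) (x : PathAlgebra K V) : Prop :=
  ∀ p ∈ (coeff x).support, p.length = n

/-- `I` can be generated, as a two-sided ideal, by homogeneous elements. -/
def IsHomogeneousIdeal (I : Ideal (PathAlgebra K V)) : Prop :=
  ∃ X : Set (PathAlgebra K V), (∀ x ∈ X, ∃ n, IsHomogeneousOfDegree n x) ∧ I = genIdeal X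

/-- A nonzero element `x` with `a x = x = x b` for some vertices `a` and `b`. -/
def IsUniform (x : PathAlgebra K V) : Prop :=
  x ≠ 0 ∧ ∃ a b : V, ofPath K (QPath.vertex a) * x = x ∧ x * ofPath K (QPath.vertex b) = x

end ideals

end PathAlgebra

/-- An admissible order on the set of paths; `lt q p` means `p > q`. -/
structure IsAdmissibleOrder {V : Type u} [Quiver.{v} V] (lt : QPath V → QPath V → Prop) : Prop where
  wellOrder : IsWellOrder (QPath V) lt
  /-- If `p > q`, then `r p > r q`, if both are nonzero. -/
  concat_left : ∀ p q r rp rq : QPath V, lt q p →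
    QPath.concat r p = some rp → QPath.concat r q = some rq → lt rq rp
  /-- If `p > q`, then `p r > q r`, if both are nonzero. -/
  concat_right : ∀ p q r pr qr : QPath V, lt q p →
    QPath.concat p r = some pr → QPath.concat q r = some qr → lt qr pr
  /-- If `r` is a subpath of `p`, then `p ≥ r`. -/
  subpath_le : ∀ p r : QPath V, QPath.IsSubpath r p → lt r p ∨ r = p

namespace PathAlgebra

section groebner

variable {K : Type w} [Field K] {V : Type u} [Quiver.{v} V] [Fintype V]

/-- `p` is the tip of `x`: the largest path occurring in `x`. (In particular `x ≠ 0`.) -/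
def IsTip (lt : QPath V → QPath V → Prop) (x : PathAlgebra K V) (p : QPath V) : Prop :=
  p ∈ (coeff x).support ∧ ∀ q ∈ (coeff x).support, q ≠ p → lt q p

/-- The set `tip(X)` of the tips of the nonzero elements of `X`. -/
def tips (lt : QPath V → QPath V → Prop) (X : Set (PathAlgebra K V)) : Set (QPath V) :=
  {p | ∃ x ∈ X, IsTip lt x p}

/-- `G` is the reduced Groebner basis of `I` with respect to the order `lt`. -/
structure IsReducedGroebnerBasis (lt : QPath V → QPath V → Prop) (I : Ideal (PathAlgebra K V))
    (G : Set (PathAlgebra K V)) : Prop where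
  subset : G ⊆ I
  uniform : ∀ g ∈ G, IsUniform g
  span_tips : genIdeal (ofPath K '' tips lt G) = genIdeal (ofPath K '' tips lt (I : Set (PathAlgebra K V)))
  monic : ∀ g ∈ G, ∀ p, IsTip lt g p → coeff g p = 1
  reduced : ∀ g ∈ G, ∀ g' ∈ G, ∀ p ∈ (coeff g).support, ∀ t, IsTip lt g' t →
    QPath.IsSubpath t p → g = g'

/-- The ideal generated by the tips of the elements of `G`; when `G` is the reduced Groebner
basis of `I`, this is the associated monomial ideal `I_mon` of `I`. -/
def monomialIdeal (lt : QPath V → QPath V → Prop) (G : Set (PathAlgebra K V)) :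
    Ideal (PathAlgebra K V) :=
  genIdeal (ofPath K '' tips lt G)

instance (lt : QPath V → QPath V → Prop) (G : Set (PathAlgebra K V)) :
    (monomialIdeal lt G).IsTwoSided :=
  inferInstanceAs ((genIdeal (ofPath K '' tips lt G)).IsTwoSided)

end groebner

/-! ### Minimal graded projective resolutions -/

section resolutions

variable {K : Type w} [Field K] {V : Type u} [Quiver.{v} V] [Fintype V]

/-- The ideal `J / I` of `Λ = K V / I`. -/
def radical (I : Ideal (PathAlgebra K V)) [I.IsTwoSided] : Ideal (PathAlgebra K V ⧸ I) :=
  (arrowIdeal K V).map (Ideal.Quotient.mk I)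

/-- The left `Λ`-module `Λ_0 = Λ / (J / I)`. -/
abbrev LambdaZero (I : Ideal (PathAlgebra K V)) [I.IsTwoSided] : Type (max u v w) :=
  (PathAlgebra K V ⧸ I) ⧸ radical I

/-- `M`, with the homogeneous components `gr i`, is a graded left module over `Λ = K V / I`,
where `Λ` has the grading induced by the length of paths. -/
structure IsGradedModule (I : Ideal (PathAlgebra K V)) [I.IsTwoSided] (M : Type*)
    [AddCommGroup M] [Module (PathAlgebra K V ⧸ I) M] (gr : ℤ → AddSubgroup M) : Prop where
  isInternal : DirectSum.IsInternal gr
  smul_mem : ∀ (n : ℕ) (x : PathAlgebra K V), IsHomogeneousOfDegree n x →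
    ∀ (i : ℤ), ∀ m ∈ gr i, Ideal.Quotient.mk I x • m ∈ gr (n + i)

/-- A minimal graded projective resolution `⋯ → P 2 → P 1 → P 0 → Λ_0 → 0` of the left
`Λ`-module `Λ_0`, which is graded with support concentrated in degree `0`. -/
structure MinimalGradedResolution (I : Ideal (PathAlgebra K V)) [I.IsTwoSided] where
  P : ℕ → Type (max u v w)
  [addCommGroup : ∀ n, AddCommGroup (P n)]
  [module : ∀ n, Module (PathAlgebra K V ⧸ I) (P n)]
  /-- The homogeneous components of `P n`. -/
  gr : ∀ n, ℤ → AddSubgroup (P n)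
  graded : ∀ n, IsGradedModule I (P n) (gr n)
  projective : ∀ n, Module.Projective (PathAlgebra K V ⧸ I) (P n)
  /-- The differential. -/
  d : ∀ n, P (n + 1) →ₗ[PathAlgebra K V ⧸ I] P n
  /-- The augmentation. -/
  ε : P 0 →ₗ[PathAlgebra K V ⧸ I] LambdaZero I
  d_degree : ∀ n i, ∀ x ∈ gr (n + 1) i, d n x ∈ gr n i
  /-- The augmentation has degree `0`. -/
  ε_degree : ∀ i : ℤ, i ≠ 0 → ∀ x ∈ gr 0 i, ε x = 0
  ε_surjective : Function.Surjective ε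
  exact_zero : Function.Exact (d 0) ε
  exact_succ : ∀ n, Function.Exact (d (n + 1)) (d n)
  minimal : ∀ n, LinearMap.range (d n) ≤ radical I • (⊤ : Submodule (PathAlgebra K V ⧸ I) (P n))

attribute [instance] MinimalGradedResolution.addCommGroup MinimalGradedResolution.module

/-- `Λ = K V / I` is `F`-determined: the `n`-th module of a minimal graded projective resolution
of `Λ_0` (which is unique up to isomorphism) can be generated in degree `F n`, for every `n`. -/
def IsFDetermined (I : Ideal (PathAlgebra K V)) [I.IsTwoSided] (F : ℕ → ℕ) : Prop :=
  ∃ R : MinimalGradedResolution I, ∀ n,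
    Submodule.span (PathAlgebra K V ⧸ I) (R.gr n (F n) : Set (R.P n)) = ⊤

end resolutions

/-! ### The Anick-Green-Solberg resolution

Write `R` for the path algebra. The resolution is built from sets `f^n` of elements of `R`:
`f^0` is the set of vertices, `f^1` the set of arrows, and, with the left ideals
`A^n = ⨁ R f^n_i` and `I A^n = ⨁ I f^n_i`, the next set is read off from the left ideal
`N^n = (⨁ R f^(n-1)_i) ∩ (⨁ I f^(n-2)_i)`: it consists of the members of the reduced left Groebner
basis of `N^n` whose tips are not tips of elements of `⨁ I f^(n-1)_i ⊆ N^n`. The members with tips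
in `tip (⨁ I f^(n-1)_i)` can be replaced by elements `f^n_i'` of `⨁ I f^(n-1)_i`, so that
`N^n = (⨁ R f^n_i) ⊕ (⨁ R f^n_i')`. -/

section ags

variable {K : Type w} [Field K] {V : Type u} [Quiver.{v} V] [Fintype V]

/-- The reduced left Groebner basis of the left ideal `N`: the `x ∈ N` such that the tip `p` of
`x` has coefficient `1`, no proper terminal subpath of `p` is the tip of an element of `N`, and no
path other than `p` occurring in `x` is the tip of an element of `N`. -/
def reducedLeftGroebnerBasis (lt : QPath V → QPath V → Prop) (N : Ideal (PathAlgebra K V)) :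
    Set (PathAlgebra K V) :=
  {x | x ∈ N ∧ ∃ p, IsTip lt x p ∧ coeff x p = 1 ∧
    (∀ q ∈ tips lt (N : Set (PathAlgebra K V)), QPath.IsSuffix q p → q = p) ∧
    (∀ q ∈ (coeff x).support, q ≠ p → q ∉ tips lt (N : Set (PathAlgebra K V)))}

/-- The sets `f^n`, for `n = 0, 1, 2, …`. -/
def agsSet (lt : QPath V → QPath V → Prop) (I : Ideal (PathAlgebra K V)) :
    ℕ → Set (PathAlgebra K V)
  | 0 => vertexSet K V
  | 1 => arrowSet K V
  | n + 2 =>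
    {x | x ∈ reducedLeftGroebnerBasis lt
          (Ideal.span (agsSet lt I (n + 1)) ⊓ I * Ideal.span (agsSet lt I n)) ∧
      ∀ p, IsTip lt x p →
        p ∉ tips lt ((I * Ideal.span (agsSet lt I (n + 1)) : Ideal (PathAlgebra K V)) :
          Set (PathAlgebra K V))}

/-- The left ideal `A^n = ⨁ R f^n_i`. -/
def agsIdeal (lt : QPath V → QPath V → Prop) (I : Ideal (PathAlgebra K V)) (n : ℕ) :
    Ideal (PathAlgebra K V) :=
  Ideal.span (agsSet lt I n)

theorem span_vertexSet : Ideal.span (vertexSet K V) = ⊤ := by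
  rw [Ideal.eq_top_iff_one]
  exact Ideal.sum_mem _ fun a _ => Ideal.subset_span ⟨a, rfl⟩

theorem agsIdeal_succ_le (lt : QPath V → QPath V → Prop) (I : Ideal (PathAlgebra K V)) :
    ∀ n, agsIdeal lt I (n + 1) ≤ agsIdeal lt I n
  | 0 => by
    have h : agsIdeal lt I 0 = ⊤ := by
      rw [agsIdeal, agsSet]
      exact span_vertexSet
    rw [h]
    exact le_top
  | n + 1 => by
    refine Ideal.span_le.mpr fun x hx => ?_
    rw [agsSet] at hx
    exact hx.1.1.1

/-- The `n`-th module `Q^n = (⨁ R f^n_i) / (⨁ I f^n_i) ≅ ⨁ Λ o(f^n_i)` of the AGS resolution; it is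
annihilated by `I`, that is, it is a `Λ`-module. -/
abbrev AGSModule (lt : QPath V → QPath V → Prop) (I : Ideal (PathAlgebra K V)) (n : ℕ) :
    Type (max u v w) :=
  agsIdeal lt I n ⧸ I • (⊤ : Submodule (PathAlgebra K V) (agsIdeal lt I n))

/-- The map `Q^(n+1) → Q^n`, `R`-linearly: if `f^(n+1)_i = ∑ h_ij f^n_j`, the class of `f^(n+1)_i`
goes to the sum of the classes of the `h_ij f^n_j`. -/
def agsMap (lt : QPath V → QPath V → Prop) (I : Ideal (PathAlgebra K V)) (n : ℕ) :
    AGSModule lt I (n + 1) →ₗ[PathAlgebra K V] AGSModule lt I n :=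
  Submodule.mapQ _ _ (Submodule.inclusion (agsIdeal_succ_le lt I n)) (by
    rw [← Submodule.map_le_iff_le_comap, Submodule.map_smul'']
    exact Submodule.smul_mono le_rfl le_top)

/-- The differential `Q^(n+1) → Q^n` of the AGS resolution. -/
def agsDifferential (lt : QPath V → QPath V → Prop) (I : Ideal (PathAlgebra K V)) [I.IsTwoSided]
    (n : ℕ) : AGSModule lt I (n + 1) →ₗ[PathAlgebra K V ⧸ I] AGSModule lt I n where
  toFun := agsMap lt I n
  map_add' := map_add _
  map_smul' := by
    intro r x
    obtain ⟨r, rfl⟩ := Ideal.Quotient.mk_surjective r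
    exact map_smul (agsMap lt I n) r x

/-- The AGS resolution of `Λ_0` is minimal: for each `n ≥ 1`, the image of the `n`-th module in
the previous one is contained in `J / I` times the latter. -/
def AGSIsMinimal (lt : QPath V → QPath V → Prop) (I : Ideal (PathAlgebra K V)) [I.IsTwoSided] :
    Prop :=
  ∀ n, LinearMap.range (agsDifferential lt I n) ≤
    radical I • (⊤ : Submodule (PathAlgebra K V ⧸ I) (AGSModule lt I n))

end ags

end PathAlgebra

end

/-! Write `A^n = ⨁ R f^n_i` and `N^(n+2) = A^(n+1) ∩ I A^n`. If the AGS resolution of `Λ_0` over `Λ`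
is minimal, it is a minimal graded projective resolution, and two of those have the same generating
degrees modulo the radical. Since no element of `f^n` lies in `J A^n`, this forces every element of
`f^n` to be homogeneous of degree `F n`, so its tip has length `F n`
(`isHomogeneousOfDegree_of_le_sup`, `MinimalGradedResolution.top_le_span_sup`). No appeal to
Nakayama's lemma is needed.

The tips of `f^n` depend only on `tip(I)` (`tips_agsSet_congr`), and `I` and `I_mon` have the same
tips. For `I_mon` the sets `f^n` consist of paths, which are therefore exactly the tips of the sets
`f^n` of `I` and have length `F n`. The AGS resolution of a monomial algebra is always minimal
(`agsIsMinimal_of_isMonomialIdeal`), so it shows that `Λ_mon` is `F`-determined.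

The delicate point is the dependence on tips, because in general the tips of an intersection of left
ideals are not determined by the tips of the two ideals. Here `A^(n+2)` and `I A^(n+1)` both lie in
`N^(n+2)`, and every tip of `N^(n+2)` is a tip of one of them. Division then gives `tip(A^(n+2) ∩ I
A^(n+1)) = tip(A^(n+2)) ∩ tip(I A^(n+1))` (`tips_inf`), and both sets on the right are sets of
concatenations with tips of `f^(n+2)` or `f^(n+1)`, since these sets are tip bases
(`IsTipBasis.tips_mul_span`).

The comparison of resolutions uses a degree-`0` chain map `φ` and an arbitrary chain map `ψ` back.
As `φ ψ` is homotopic to the identity and the target is minimal, `φ` is surjective modulo the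
radical (`exists_homotopy`). -/

noncomputable section

/-! ### Concatenation and terminal subpaths. -/

namespace Quiver.Path

/-- Of two terminal subpaths of the same path, one is a terminal subpath of the other. -/
theorem exists_comp_of_comp_eq {V : Type u} [Quiver.{v} V] {a b b' c : V} (p : Path a b)
    (q : Path b c) (p' : Path a b') (q' : Path b' c) (h : p.comp q = p'.comp q') :
    (∃ r : Path b' b, r.comp q = q') ∨ ∃ r : Path b b', r.comp q' = q := by
  induction q with
  | nil => exact Or.inl ⟨q', rfl⟩
  | cons q e ih =>
    cases q' with
    | nil => exact Or.inr ⟨q.cons e, rfl⟩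
    | cons q' e' =>
      rw [comp_cons, comp_cons] at h
      obtain rfl := obj_eq_of_cons_eq_cons h
      have h₁ := eq_of_heq (heq_of_cons_eq_cons h)
      have h₂ := eq_of_heq (hom_heq_of_cons_eq_cons h)
      subst h₂
      rcases ih q' h₁ with ⟨r, hr⟩ | ⟨r, hr⟩
      · exact Or.inl ⟨r, by rw [comp_cons, hr]⟩
      · exact Or.inr ⟨r, by rw [comp_cons, hr]⟩

end Quiver.Path

namespace QPath

variable {V : Type u} [Quiver.{v} V]

theorem exists_concat {p q : QPath V} (h : q.source = p.target) : ∃ r, concat p q = some r := by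
  obtain ⟨a, b, p⟩ := p
  obtain ⟨c, d, q⟩ := q
  obtain rfl : c = b := h
  exact ⟨_, concat_mk p q⟩

theorem concat_eq_some {p q r : QPath V} (h : concat p q = some r) :
    q.source = p.target ∧ r.source = p.source ∧ r.target = q.target ∧
      r.length = p.length + q.length := by
  obtain ⟨a, b, p⟩ := p
  obtain ⟨c, d, q⟩ := q
  by_cases hc : c = b
  · subst hc
    rw [concat_mk] at h
    obtain rfl := Option.some.inj h
    exact ⟨rfl, rfl, rfl, Quiver.Path.length_comp p q⟩
  · exact absurd ((concat_eq_none (p := ⟨a, b, p⟩) (q := ⟨c, d, q⟩) hc).symm.trans h) (by simp)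

theorem concat_assoc_some' {p q r qr x : QPath V} (h₁ : concat q r = some qr)
    (h₂ : concat p qr = some x) : ∃ pq, concat p q = some pq ∧ concat pq r = some x := by
  have h := concat_assoc p q r
  rw [h₁, Option.bind_some, h₂] at h
  exact Option.bind_eq_some_iff.1 h

theorem vertex_source_concat (p : QPath V) : concat (vertex p.source) p = some p := by
  classical
  exact (vertex_concat p p.source).trans (if_pos rfl)

theorem concat_vertex_target (p : QPath V) : concat p (vertex p.target) = some p := by
  classical
  exact (concat_vertex p p.target).trans (if_pos rfl)

theorem length_vertex (a : V) : (vertex a).length = 0 := rfl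

theorem length_arrow {a b : V} (e : a ⟶ b) : (arrow e).length = 1 := rfl

theorem eq_vertex_of_length {p : QPath V} (h : p.length = 0) : p = vertex p.source := by
  obtain ⟨a, b, p⟩ := p
  cases p with
  | nil => rfl
  | cons p e => exact absurd h (Nat.succ_ne_zero _)

theorem exists_concat_arrow {p : QPath V} (h : 1 ≤ p.length) :
    ∃ (r : QPath V) (a b : V) (e : a ⟶ b), concat r (arrow e) = some p := by
  obtain ⟨a, b, p⟩ := p
  cases p with
  | nil => exact absurd h (by simp [length])
  | cons p e => exact ⟨⟨_, _, p⟩, _, _, e, concat_mk p e.toPath⟩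

theorem exists_eq_arrow {p : QPath V} (h : p.length = 1) :
    ∃ (a b : V) (e : a ⟶ b), p = arrow e := by
  obtain ⟨r, a, b, e, he⟩ := exists_concat_arrow h.ge
  have hl := (concat_eq_some he).2.2.2
  rw [length_arrow, h] at hl
  have h₀ := eq_vertex_of_length (p := r) (by omega)
  have hs := (concat_eq_some he).1
  have ht : r.target = r.source := by rw [h₀]; rfl
  rw [h₀, ← ht, ← hs, vertex_source_concat] at he
  exact ⟨a, b, e, (Option.some.inj he).symm⟩

theorem IsSuffix.isSubpath {p q : QPath V} (h : IsSuffix p q) : IsSubpath p q := by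
  obtain ⟨r, hr⟩ := h
  exact ⟨r, vertex q.target, q, hr, concat_vertex_target q⟩

theorem IsSuffix.trans {p q r : QPath V} (h : IsSuffix p q) (h' : IsSuffix q r) :
    IsSuffix p r := by
  obtain ⟨s, hs⟩ := h
  obtain ⟨t, ht⟩ := h'
  obtain ⟨ts, -, h⟩ := concat_assoc_some' hs ht
  exact ⟨ts, h⟩

theorem isSuffix_or_isSuffix {p q p' q' r : QPath V} (h : concat p q = some r)
    (h' : concat p' q' = some r) : IsSuffix q q' ∨ IsSuffix q' q := by
  obtain ⟨a, b, p⟩ := p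
  obtain ⟨c, d, q⟩ := q
  obtain ⟨a', b', p'⟩ := p'
  obtain ⟨c', d', q'⟩ := q'
  obtain rfl : c = b := (concat_eq_some h).1
  obtain rfl : c' = b' := (concat_eq_some h').1
  obtain rfl : a = a' := (concat_eq_some h).2.1.symm.trans (concat_eq_some h').2.1
  obtain rfl : d = d' := (concat_eq_some h).2.2.1.symm.trans (concat_eq_some h').2.2.1
  rw [concat_mk] at h h'
  have e := Option.some.inj (h.trans h'.symm)
  have e' : p.comp q = p'.comp q' :=
    eq_of_heq (Sigma.mk.inj (eq_of_heq (Sigma.mk.inj e).2)).2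
  rcases Quiver.Path.exists_comp_of_comp_eq p q p' q' e' with ⟨r, hr⟩ | ⟨r, hr⟩
  · exact Or.inl ⟨⟨_, _, r⟩, by rw [concat_mk, hr]⟩
  · exact Or.inr ⟨⟨_, _, r⟩, by rw [concat_mk, hr]⟩

end QPath

namespace PathAlgebra

/-! ### Coefficients and supports in the path algebra. -/

section basics

variable {K : Type w} [Field K] {V : Type u} [Quiver.{v} V]

@[ext]
theorem ext {x y : PathAlgebra K V} (h : ∀ p, coeff x p = coeff y p) : x = y :=
  Finsupp.ext h

@[simp] theorem coeff_zero : coeff (0 : PathAlgebra K V) = 0 := rfl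

@[simp] theorem coeff_add (x y : PathAlgebra K V) : coeff (x + y) = coeff x + coeff y := rfl

@[simp] theorem coeff_sub (x y : PathAlgebra K V) : coeff (x - y) = coeff x - coeff y := rfl

@[simp] theorem coeff_smul (c : K) (x : PathAlgebra K V) : coeff (c • x) = c • coeff x := rfl

theorem coeff_ofPath (p : QPath V) : coeff (ofPath K p) = Finsupp.single p 1 := rfl

theorem coeff_sum {ι : Type*} (s : Finset ι) (f : ι → PathAlgebra K V) :
    coeff (∑ i ∈ s, f i) = ∑ i ∈ s, coeff (f i) :=
  map_sum (AddMonoidHom.id (QPath V →₀ K)) f s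

theorem coeff_eq_zero {x : PathAlgebra K V} : coeff x = 0 ↔ x = 0 := Iff.rfl

theorem sum_coeff_smul (x : PathAlgebra K V) :
    ∑ p ∈ (coeff x).support, coeff x p • ofPath K p = x := by
  have h := Finsupp.sum_single (coeff x)
  refine Eq.trans ?_ h
  refine Finset.sum_congr rfl fun p _ => ?_
  exact (Finsupp.smul_single_one p _)

theorem induction_on {P : PathAlgebra K V → Prop} (x : PathAlgebra K V) (zero : P 0)
    (add : ∀ x y, P x → P y → P (x + y)) (smul : ∀ (c : K) p, P (c • ofPath K p)) : P x := by
  rw [← sum_coeff_smul x]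
  exact Finset.sum_induction _ P (fun x y => add x y) zero fun p _ => smul _ _

theorem support_ofPath (p : QPath V) : (coeff (ofPath K p)).support = {p} :=
  Finsupp.support_single _ one_ne_zero

theorem mem_support_add {x y : PathAlgebra K V} {p : QPath V}
    (h : p ∈ (coeff (x + y)).support) : p ∈ (coeff x).support ∨ p ∈ (coeff y).support := by
  classical
  exact Finset.mem_union.1 (Finsupp.support_add h)

theorem mem_support_sub {x y : PathAlgebra K V} {p : QPath V}
    (h : p ∈ (coeff (x - y)).support) : p ∈ (coeff x).support ∨ p ∈ (coeff y).support := by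
  classical
  exact Finset.mem_union.1 (Finsupp.support_sub h)

theorem mem_support_smul {c : K} {x : PathAlgebra K V} {p : QPath V}
    (h : p ∈ (coeff (c • x)).support) : p ∈ (coeff x).support :=
  Finsupp.support_smul h

theorem mem_support_sum {ι : Type*} {s : Finset ι} {f : ι → PathAlgebra K V} {p : QPath V}
    (h : p ∈ (coeff (∑ i ∈ s, f i)).support) : ∃ i ∈ s, p ∈ (coeff (f i)).support := by
  by_contra! hn
  rw [Finsupp.mem_support_iff, coeff_sum, Finsupp.finsetSum_apply] at h
  exact h (Finset.sum_eq_zero fun i hi => Finsupp.notMem_support_iff.1 (hn i hi))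

variable [Fintype V]

instance : IsScalarTower K (PathAlgebra K V) (PathAlgebra K V) :=
  ⟨fun c x y => (pathMulMap K V).map_smul₂ c x y⟩

instance : SMulCommClass K (PathAlgebra K V) (PathAlgebra K V) :=
  ⟨fun c x y => ((pathMulMap K V x).map_smul c y).symm⟩

theorem ofPath_mul_ofPath (p q : QPath V) :
    ofPath K p * ofPath K q = (p.concat q).elim 0 (ofPath K) :=
  pathMulMap_single p q

theorem ofPath_mul_of_concat {p q r : QPath V} (h : p.concat q = some r) :
    ofPath K p * ofPath K q = ofPath K r := by
  rw [ofPath_mul_ofPath, h]; rfl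

theorem mul_eq_sum (x y : PathAlgebra K V) :
    x * y = ∑ a ∈ (coeff x).support, ∑ b ∈ (coeff y).support,
      (coeff x a * coeff y b) • (ofPath K a * ofPath K b) := by
  conv_lhs => rw [← sum_coeff_smul x, ← sum_coeff_smul y]
  rw [Finset.sum_mul_sum]
  refine Finset.sum_congr rfl fun a _ => Finset.sum_congr rfl fun b _ => ?_
  rw [smul_mul_smul_comm]

theorem mem_support_mul {x y : PathAlgebra K V} {p : QPath V}
    (h : p ∈ (coeff (x * y)).support) :
    ∃ a ∈ (coeff x).support, ∃ b ∈ (coeff y).support, QPath.concat a b = some p := by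
  rw [mul_eq_sum] at h
  obtain ⟨a, ha, h⟩ := mem_support_sum h
  obtain ⟨b, hb, h⟩ := mem_support_sum h
  refine ⟨a, ha, b, hb, ?_⟩
  have h := mem_support_smul h
  rw [ofPath_mul_ofPath] at h
  cases hc : QPath.concat a b with
  | none => rw [hc] at h; simp at h
  | some r =>
    rw [hc, Option.elim_some, support_ofPath, Finset.mem_singleton] at h
    rw [h]

theorem smul_mem_ideal (N : Ideal (PathAlgebra K V)) (c : K) {x : PathAlgebra K V} (hx : x ∈ N) :
    c • x ∈ N := by
  rw [← one_mul x, ← smul_mul_assoc]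
  exact N.mul_mem_left _ hx

/-- The underlying vector space of a left ideal. -/
def subspace (N : Ideal (PathAlgebra K V)) : Submodule K (PathAlgebra K V) where
  carrier := N
  zero_mem' := N.zero_mem
  add_mem' := N.add_mem
  smul_mem' c _ hx := smul_mem_ideal N c hx

theorem ofPath_vertex_mul_of_source {x : PathAlgebra K V} {a : V}
    (h : ∀ p ∈ (coeff x).support, p.source = a) : ofPath K (QPath.vertex a) * x = x := by
  conv_rhs => rw [← sum_coeff_smul x]
  conv_lhs => rw [← sum_coeff_smul x]
  rw [Finset.mul_sum]
  refine Finset.sum_congr rfl fun p hp => ?_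
  rw [mul_smul_comm, ← h p hp, ofPath_mul_of_concat p.vertex_source_concat]

theorem coeff_vertex_mul (x : PathAlgebra K V) (a : V) (p : QPath V) [Decidable (p.source = a)] :
    coeff (ofPath K (QPath.vertex a) * x) p = if p.source = a then coeff x p else 0 := by
  classical
  induction x using induction_on with
  | zero => simp
  | add x y hx hy => rw [mul_add, coeff_add, Finsupp.add_apply, hx, hy]; split_ifs <;> simp
  | smul c q =>
    rw [mul_smul_comm, ofPath_mul_ofPath, QPath.vertex_concat]
    by_cases h : a = q.1
    · rw [if_pos h, Option.elim_some, coeff_smul, coeff_ofPath]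
      by_cases hq : q = p
      · subst hq; exact (if_pos h.symm).symm
      · simp [Finsupp.single_eq_of_ne' hq]
    · rw [if_neg h, Option.elim_none]
      by_cases hq : q = p
      · subst hq; rw [if_neg (fun h' => h h'.symm)]; simp
      · simp [coeff_ofPath, Finsupp.single_eq_of_ne' hq]

theorem coeff_mul_vertex (x : PathAlgebra K V) (a : V) (p : QPath V) [Decidable (p.target = a)] :
    coeff (x * ofPath K (QPath.vertex a)) p = if p.target = a then coeff x p else 0 := by
  classical
  induction x using induction_on with
  | zero => simp
  | add x y hx hy => rw [add_mul, coeff_add, Finsupp.add_apply, hx, hy]; split_ifs <;> simp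
  | smul c q =>
    rw [smul_mul_assoc, ofPath_mul_ofPath, QPath.concat_vertex]
    by_cases h : a = q.2.1
    · rw [if_pos h, Option.elim_some, coeff_smul, coeff_ofPath]
      by_cases hq : q = p
      · subst hq; exact (if_pos h.symm).symm
      · simp [Finsupp.single_eq_of_ne' hq]
    · rw [if_neg h, Option.elim_none]
      by_cases hq : q = p
      · subst hq; rw [if_neg (fun h' => h h'.symm)]; simp
      · simp [coeff_ofPath, Finsupp.single_eq_of_ne' hq]

end basics

end PathAlgebra

/-! ### Admissible orders. -/

namespace IsAdmissibleOrder

variable {V : Type u} [Quiver.{v} V] {lt : QPath V → QPath V → Prop}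

theorem wf (h : IsAdmissibleOrder lt) : WellFounded lt :=
  have := h.wellOrder
  IsWellFounded.wf

theorem irrefl (h : IsAdmissibleOrder lt) (p : QPath V) : ¬ lt p p :=
  have := h.wellOrder
  irrefl_of lt p

theorem trans (h : IsAdmissibleOrder lt) {p q r : QPath V} (h₁ : lt p q) (h₂ : lt q r) : lt p r :=
  have := h.wellOrder
  trans_of lt h₁ h₂

/-- The indexed form serves both for the paths occurring in an element and for the tips of the
summands of a linear combination. -/
theorem exists_max (h : IsAdmissibleOrder lt) {ι : Type*} {s : Finset ι} (hs : s.Nonempty)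
    (f : ι → QPath V) : ∃ i ∈ s, ∀ j ∈ s, f j = f i ∨ lt (f j) (f i) := by
  classical
  have := h.wellOrder
  let := linearOrderOfSTO lt
  obtain ⟨i, hi, hm⟩ := s.exists_max_image f hs
  exact ⟨i, hi, fun j hj => (hm j hj)⟩

/-- Every element of a set of paths has a terminal subpath in the set which is minimal. -/
theorem exists_minimal_suffix (h : IsAdmissibleOrder lt) (T : Set (QPath V)) {p : QPath V}
    (hp : p ∈ T) :
    ∃ q ∈ T, QPath.IsSuffix q p ∧ ∀ q' ∈ T, QPath.IsSuffix q' q → q' = q := by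
  obtain ⟨q, ⟨hq, hs⟩, hm⟩ := h.wf.has_min {q | q ∈ T ∧ QPath.IsSuffix q p}
    ⟨p, hp, QPath.vertex p.source, p.vertex_source_concat⟩
  refine ⟨q, hq, hs, fun q' hq' hs' => ?_⟩
  rcases h.subpath_le _ _ hs'.isSubpath with hl | he
  · exact absurd hl (hm q' ⟨hq', hs'.trans hs⟩)
  · exact he

end IsAdmissibleOrder

namespace PathAlgebra

/-! ### Tips, division and normal forms. -/

section tips

variable {K : Type w} [Field K] {V : Type u} [Quiver.{v} V] {lt : QPath V → QPath V → Prop}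

theorem exists_isTip (hlt : IsAdmissibleOrder lt) {x : PathAlgebra K V} (hx : x ≠ 0) :
    ∃ p, IsTip lt x p := by
  obtain ⟨p, hp, hm⟩ := hlt.exists_max (Finsupp.support_nonempty_iff.2 (mt coeff_eq_zero.1 hx)) id
  exact ⟨p, hp, fun q hq hne => (hm q hq).resolve_left hne⟩

theorem IsTip.ne_zero {x : PathAlgebra K V} {p : QPath V} (h : IsTip lt x p) : x ≠ 0 := by
  rintro rfl
  simpa using h.1

theorem IsTip.coeff_ne_zero {x : PathAlgebra K V} {p : QPath V} (h : IsTip lt x p) :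
    coeff x p ≠ 0 :=
  Finsupp.mem_support_iff.1 h.1

theorem IsTip.unique (hlt : IsAdmissibleOrder lt) {x : PathAlgebra K V} {p q : QPath V}
    (hp : IsTip lt x p) (hq : IsTip lt x q) : p = q := by
  by_contra hn
  exact hlt.irrefl _ (hlt.trans (hp.2 q hq.1 (Ne.symm hn)) (hq.2 p hp.1 hn))

theorem isTip_ofPath (p : QPath V) : IsTip lt (ofPath K p) p := by
  refine ⟨by rw [support_ofPath]; exact Finset.mem_singleton_self p, fun q hq hne => ?_⟩
  rw [support_ofPath, Finset.mem_singleton] at hq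
  exact absurd hq hne

theorem IsTip.smul {x : PathAlgebra K V} {p : QPath V} (h : IsTip lt x p) {c : K} (hc : c ≠ 0) :
    IsTip lt (c • x) p := by
  refine ⟨?_, fun q hq => h.2 q (mem_support_smul hq)⟩
  rw [Finsupp.mem_support_iff, coeff_smul]
  exact mul_ne_zero hc h.coeff_ne_zero

/-- Cancellation of leading terms. The bound concerns all paths occurring in the difference, so that
a difference equal to `0` needs no separate case. -/
theorem IsTip.exists_sub_smul_lt {x y : PathAlgebra K V} {p : QPath V} (hx : IsTip lt x p)
    (hy : IsTip lt y p) : ∃ c : K, c ≠ 0 ∧ ∀ q ∈ (coeff (x - c • y)).support, lt q p := by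
  refine ⟨coeff x p / coeff y p, div_ne_zero hx.coeff_ne_zero hy.coeff_ne_zero, fun q hq => ?_⟩
  have hne : q ≠ p := by
    rintro rfl
    rw [Finsupp.mem_support_iff, coeff_sub, coeff_smul] at hq
    refine hq ?_
    simp [hy.coeff_ne_zero]
  rcases mem_support_sub hq with h | h
  · exact hx.2 q h hne
  · exact hy.2 q (mem_support_smul h) hne

theorem IsTip.add_of_lt {x y : PathAlgebra K V} {p : QPath V} (hlt : IsAdmissibleOrder lt)
    (hx : IsTip lt x p) (hy : ∀ q ∈ (coeff y).support, lt q p) :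
    IsTip lt (x + y) p ∧ coeff (x + y) p = coeff x p := by
  have h0 : coeff y p = 0 := Finsupp.notMem_support_iff.1 fun h => hlt.irrefl p (hy p h)
  have h1 : coeff (x + y) p = coeff x p := by simp [h0]
  refine ⟨⟨?_, fun q hq hne => ?_⟩, h1⟩
  · rw [Finsupp.mem_support_iff, h1]; exact hx.coeff_ne_zero
  · rcases mem_support_add hq with h | h
    · exact hx.2 q h hne
    · exact hy q h

/-- Division: if every tip of `N` is a tip of `A` or of `B`, the elements of `N` are sums of
elements of `A` and `B` which do not exceed them. -/
theorem exists_add_of_tips_subset (hlt : IsAdmissibleOrder lt)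
    {A B N : Submodule K (PathAlgebra K V)} (hA : A ≤ N) (hB : B ≤ N)
    (h : tips lt (N : Set (PathAlgebra K V)) ⊆
      tips lt (A : Set (PathAlgebra K V)) ∪ tips lt (B : Set (PathAlgebra K V)))
    {z : PathAlgebra K V} (hz : z ∈ N) :
    ∃ a ∈ A, ∃ b ∈ B, z = a + b ∧
      ∀ p, (∀ q ∈ (coeff z).support, lt q p) → ∀ q ∈ (coeff a).support, lt q p := by
  have key : ∀ t, ∀ z ∈ N, IsTip lt z t → ∃ a ∈ A, ∃ b ∈ B, z = a + b ∧
      ∀ p, (∀ q ∈ (coeff z).support, lt q p) → ∀ q ∈ (coeff a).support, lt q p := by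
    intro t
    induction t using hlt.wf.induction with
    | _ t ih =>
    intro z hz ht
    -- Subtracting a multiple of any `y ∈ N` with the same tip lowers the tip, so the induction
    -- hypothesis applies to the remainder. Afterwards `c • y` is returned to `A` or to `B`,
    -- according to where `y` was found.
    have step : ∀ y ∈ N, IsTip lt y t → ∃ c : K, ∃ a ∈ A, ∃ b ∈ B, z - c • y = a + b ∧
        ∀ q ∈ (coeff a).support, lt q t := by
      intro y hy hyt
      obtain ⟨c, -, hc⟩ := ht.exists_sub_smul_lt hyt
      by_cases h0 : z - c • y = 0
      · exact ⟨c, 0, A.zero_mem, 0, B.zero_mem, by rw [h0, add_zero], by simp⟩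
      · obtain ⟨t', ht'⟩ := exists_isTip hlt h0
        obtain ⟨a, ha, b, hb, hab, hl⟩ := ih t' (hc t' ht'.1) _
          (N.sub_mem hz (N.smul_mem c hy)) ht'
        exact ⟨c, a, ha, b, hb, hab, hl t hc⟩
    rcases h ⟨z, hz, ht⟩ with ⟨y, hy, hyt⟩ | ⟨y, hy, hyt⟩
    · obtain ⟨c, a, ha, b, hb, hab, hl⟩ := step y (hA hy) hyt
      refine ⟨c • y + a, A.add_mem (A.smul_mem c hy) ha, b, hb, ?_, fun p hp q hq => ?_⟩
      · rw [add_assoc, ← hab]; abel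
      · have htp := hp t ht.1
        rcases mem_support_add hq with hq | hq
        · by_cases hqt : q = t
          · rwa [hqt]
          · exact hlt.trans (hyt.2 q (mem_support_smul hq) hqt) htp
        · exact hlt.trans (hl q hq) htp
    · obtain ⟨c, a, ha, b, hb, hab, hl⟩ := step y (hB hy) hyt
      refine ⟨a, ha, c • y + b, B.add_mem (B.smul_mem c hy) hb, ?_, fun p hp q hq => ?_⟩
      · rw [add_left_comm, ← hab]; abel
      · exact hlt.trans (hl q hq) (hp t ht.1)
  by_cases h0 : z = 0
  · exact ⟨0, A.zero_mem, 0, B.zero_mem, by rw [h0, add_zero], by simp⟩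
  · obtain ⟨t, ht⟩ := exists_isTip hlt h0
    exact key t z hz ht

/-- If `x ∈ A` and `y ∈ B` have the common tip `p`, then `x - c • y ∈ N` involves only paths below
`p` for a suitable `c`. Division writes it as `a + b` with `a` below `p`. Then `x - a = c • y + b`
lies in both subspaces and still has tip `p`. -/
theorem tips_inf (hlt : IsAdmissibleOrder lt) {A B N : Submodule K (PathAlgebra K V)}
    (hA : A ≤ N) (hB : B ≤ N)
    (h : tips lt (N : Set (PathAlgebra K V)) ⊆
      tips lt (A : Set (PathAlgebra K V)) ∪ tips lt (B : Set (PathAlgebra K V))) :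
    tips lt ((A ⊓ B : Submodule K (PathAlgebra K V)) : Set (PathAlgebra K V)) =
      tips lt (A : Set (PathAlgebra K V)) ∩ tips lt (B : Set (PathAlgebra K V)) := by
  refine Set.Subset.antisymm ?_ ?_
  · rintro p ⟨x, hx, hp⟩
    exact ⟨⟨x, hx.1, hp⟩, ⟨x, hx.2, hp⟩⟩
  · rintro p ⟨⟨x, hx, hxp⟩, ⟨y, hy, hyp⟩⟩
    obtain ⟨c, -, hc⟩ := hxp.exists_sub_smul_lt hyp
    obtain ⟨a, ha, b, hb, hab, hl⟩ := exists_add_of_tips_subset hlt hA hB h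
      (N.sub_mem (hA hx) (N.smul_mem c (hB hy)))
    refine ⟨x - a, ⟨A.sub_mem hx ha, ?_⟩, ?_⟩
    · have : x - a = c • y + b := by
        rw [sub_eq_iff_eq_add] at hab ⊢
        rw [hab]; abel
      rw [this]
      exact B.add_mem (B.smul_mem c hy) hb
    · rw [sub_eq_add_neg]
      refine (hxp.add_of_lt hlt fun q hq => hl p hc q ?_).1
      rw [← neg_one_smul K a] at hq
      exact mem_support_smul hq

/-- The elements in which no tip of elements of `N` occurs. -/
def normalForms (lt : QPath V → QPath V → Prop) (N : Set (PathAlgebra K V)) :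
    Submodule K (PathAlgebra K V) where
  carrier := {x | ∀ p ∈ (coeff x).support, p ∉ tips lt N}
  zero_mem' := by simp
  add_mem' hx hy p hp := (mem_support_add hp).elim (hx p) (hy p)
  smul_mem' c x hx p hp := hx p (mem_support_smul hp)

/-- Take `p` minus its normal form modulo `N`. The normal form comes from division in the whole
algebra, where every path is either a tip of `N` or a normal form itself. -/
theorem exists_isTip_normal (hlt : IsAdmissibleOrder lt) (N : Submodule K (PathAlgebra K V))
    {p : QPath V} (hp : p ∈ tips lt (N : Set (PathAlgebra K V))) :
    ∃ x ∈ N, IsTip lt x p ∧ coeff x p = 1 ∧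
      ∀ q ∈ (coeff x).support, q ≠ p → q ∉ tips lt (N : Set (PathAlgebra K V)) := by
  obtain ⟨y, hy, hyp⟩ := hp
  obtain ⟨c, -, hc⟩ := (isTip_ofPath (K := K) p).exists_sub_smul_lt hyp
  obtain ⟨a, ha, b, hb, hab, hl⟩ := exists_add_of_tips_subset hlt (A := N)
    (B := normalForms lt (N : Set (PathAlgebra K V))) (N := ⊤) le_top le_top
    (fun q _ => by
      by_cases hq : q ∈ tips lt (N : Set (PathAlgebra K V))
      · exact Or.inl hq
      · refine Or.inr ⟨ofPath K q, fun r hr => ?_, isTip_ofPath q⟩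
        rw [support_ofPath, Finset.mem_singleton] at hr
        rwa [hr]) (z := ofPath K p - c • y) trivial
  have hb' : ∀ q ∈ (coeff b).support, lt q p := fun q hq => by
    rw [← sub_eq_iff_eq_add'.2 hab] at hq
    exact (mem_support_sub hq).elim (hc q) (hl p hc q)
  have e : ofPath K p + (-1 : K) • b = c • y + a := by
    rw [neg_one_smul, ← sub_eq_add_neg, sub_eq_iff_eq_add, add_assoc, ← hab]; abel
  have ht := (isTip_ofPath (K := K) p).add_of_lt hlt (y := (-1 : K) • b)
    fun q hq => hb' q (mem_support_smul hq)
  refine ⟨ofPath K p + (-1 : K) • b, ?_, ht.1, ?_, fun q hq hne => ?_⟩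
  · rw [e]; exact N.add_mem (N.smul_mem c hy) ha
  · rw [ht.2, coeff_ofPath, Finsupp.single_eq_same]
  · rcases mem_support_add hq with hq | hq
    · rw [support_ofPath, Finset.mem_singleton] at hq
      exact absurd hq hne
    · exact hb q (mem_support_smul hq)

end tips

/-! ### Tips of products. -/

section products

variable {K : Type w} [Field K] {V : Type u} [Quiver.{v} V] [Fintype V]
  {lt : QPath V → QPath V → Prop}

/-- By `H`, only the pair `(t, q)` contributes to the coefficient of `p`, which is therefore the
product of two nonzero scalars. -/
theorem isTip_mul_of_forall {x y : PathAlgebra K V} {t q p : QPath V} (hx : IsTip lt x t)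
    (hy : IsTip lt y q) (h : QPath.concat t q = some p)
    (hlt : IsAdmissibleOrder lt)
    (H : ∀ a ∈ (coeff x).support, ∀ b ∈ (coeff y).support, ∀ r, QPath.concat a b = some r →
      (a = t ∧ b = q) ∨ lt r p) :
    IsTip lt (x * y) p := by
  classical
  have hc : coeff (x * y) p = coeff x t * coeff y q := by
    rw [mul_eq_sum, coeff_sum, Finsupp.finsetSum_apply, Finset.sum_eq_single t,
      coeff_sum, Finsupp.finsetSum_apply, Finset.sum_eq_single q]
    · rw [ofPath_mul_of_concat h, coeff_smul, coeff_ofPath]; simp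
    · intro b hb hne
      by_contra hn
      rw [← ne_eq, ← Finsupp.mem_support_iff] at hn
      obtain ⟨a', ha', b', hb', hr⟩ := mem_support_mul (mem_support_smul hn)
      rw [support_ofPath, Finset.mem_singleton] at ha' hb'
      subst ha' hb'
      rcases H _ hx.1 _ hb _ hr with h' | h'
      · exact hne h'.2
      · exact hlt.irrefl _ h'
    · intro hn; exact absurd hy.1 hn
    · intro a ha hne
      by_contra hn
      rw [← ne_eq, ← Finsupp.mem_support_iff] at hn
      obtain ⟨b, hb, hn⟩ := mem_support_sum hn
      obtain ⟨a', ha', b', hb', hr⟩ := mem_support_mul (mem_support_smul hn)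
      rw [support_ofPath, Finset.mem_singleton] at ha' hb'
      subst ha' hb'
      rcases H _ ha _ hb _ hr with h' | h'
      · exact hne h'.1
      · exact hlt.irrefl _ h'
    · intro hn; exact absurd hx.1 hn
  refine ⟨?_, fun r hr hne => ?_⟩
  · rw [Finsupp.mem_support_iff, hc]
    exact mul_ne_zero hx.coeff_ne_zero hy.coeff_ne_zero
  · obtain ⟨a, ha, b, hb, hab⟩ := mem_support_mul hr
    rcases H a ha b hb r hab with ⟨rfl, rfl⟩ | h'
    · exact absurd (Option.some.inj (hab.symm.trans h)) hne
    · exact h'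

/-- The tip of a product whose right factor is left uniform. -/
theorem IsTip.mul_of_source (hlt : IsAdmissibleOrder lt) {x y : PathAlgebra K V} {t q p : QPath V}
    (hx : IsTip lt x t) (hy : IsTip lt y q) (h : QPath.concat t q = some p)
    (hu : ∀ b ∈ (coeff y).support, b.source = q.source) : IsTip lt (x * y) p := by
  -- For composable `a` and `b` the comparison is `a b ≤ t b ≤ t q`. The middle path exists because
  -- `b` starts where `q` does; this is the role of left uniformity.
  refine isTip_mul_of_forall hx hy h hlt fun a ha b hb r hr => ?_
  obtain ⟨tb, htb⟩ := QPath.exists_concat (p := t) (q := b)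
    ((hu b hb).trans (QPath.concat_eq_some h).1)
  by_cases hbq : b = q
  · by_cases hat : a = t
    · exact Or.inl ⟨hat, hbq⟩
    · subst hbq
      exact Or.inr (hlt.concat_right _ _ _ _ _ (hx.2 a ha hat) h hr)
  · have h₁ := hlt.concat_left _ _ _ _ _ (hy.2 b hb hbq) h htb
    by_cases hat : a = t
    · subst hat
      rw [htb] at hr
      exact Or.inr (Option.some.inj hr ▸ h₁)
    · exact Or.inr (hlt.trans (hlt.concat_right _ _ _ _ _ (hx.2 a ha hat) htb hr) h₁)

theorem IsTip.ofPath_mul (hlt : IsAdmissibleOrder lt) {y : PathAlgebra K V} {t q p : QPath V}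
    (hy : IsTip lt y q) (h : QPath.concat t q = some p) : IsTip lt (ofPath K t * y) p := by
  refine isTip_mul_of_forall (isTip_ofPath t) hy h hlt fun a ha b hb r hr => ?_
  rw [support_ofPath, Finset.mem_singleton] at ha
  subst ha
  by_cases hbq : b = q
  · exact Or.inl ⟨rfl, hbq⟩
  · exact Or.inr (hlt.concat_left _ _ _ _ _ (hy.2 b hb hbq) h hr)

theorem IsTip.mul_ofPath (hlt : IsAdmissibleOrder lt) {x : PathAlgebra K V} {t q p : QPath V}
    (hx : IsTip lt x t) (h : QPath.concat t q = some p) : IsTip lt (x * ofPath K q) p := by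
  refine isTip_mul_of_forall hx (isTip_ofPath q) h hlt fun a ha b hb r hr => ?_
  rw [support_ofPath, Finset.mem_singleton] at hb
  subst hb
  by_cases hat : a = t
  · exact Or.inl ⟨hat, rfl⟩
  · exact Or.inr (hlt.concat_right _ _ _ _ _ (hx.2 a ha hat) h hr)

theorem concat_mem_tips (hlt : IsAdmissibleOrder lt) {N : Ideal (PathAlgebra K V)}
    {t q p : QPath V} (hq : q ∈ tips lt (N : Set (PathAlgebra K V)))
    (h : QPath.concat t q = some p) : p ∈ tips lt (N : Set (PathAlgebra K V)) := by
  obtain ⟨x, hx, hxq⟩ := hq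
  exact ⟨_, N.mul_mem_left _ hx, hxq.ofPath_mul hlt h⟩

theorem concat_mem_tips_right (hlt : IsAdmissibleOrder lt) {N : Ideal (PathAlgebra K V)}
    [N.IsTwoSided] {t q p : QPath V} (ht : t ∈ tips lt (N : Set (PathAlgebra K V)))
    (h : QPath.concat t q = some p) : p ∈ tips lt (N : Set (PathAlgebra K V)) := by
  obtain ⟨x, hx, hxt⟩ := ht
  exact ⟨_, N.mul_mem_right _ hx, hxt.mul_ofPath hlt h⟩

end products

end PathAlgebra

namespace PathAlgebra

/-! ### Left ideals that are direct sums `⨁ R s`, recognised by tips. -/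

section tipBasis

variable {K : Type w} [Field K] {V : Type u} [Quiver.{v} V]

/-- A set of nonzero left uniform elements none of whose tips is a terminal subpath of the tip of
another one. Such a set is a basis of a left ideal which is a direct sum `⨁ R s`. -/
structure IsTipBasis (lt : QPath V → QPath V → Prop) (S : Set (PathAlgebra K V)) : Prop where
  exists_tip : ∀ s ∈ S, ∃ p, IsTip lt s p ∧ ∀ b ∈ (coeff s).support, b.source = p.source
  eq_of_isSuffix : ∀ s ∈ S, ∀ s' ∈ S, ∀ p p', IsTip lt s p → IsTip lt s' p' →
    QPath.IsSuffix p p' → s = s'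

variable {lt : QPath V → QPath V → Prop} {S : Set (PathAlgebra K V)}

theorem IsTipBasis.source_eq (hS : IsTipBasis lt S) (hlt : IsAdmissibleOrder lt)
    {s : PathAlgebra K V} (hs : s ∈ S) {p : QPath V} (hp : IsTip lt s p) :
    ∀ b ∈ (coeff s).support, b.source = p.source := by
  obtain ⟨q, hq, h⟩ := hS.exists_tip s hs
  rwa [hp.unique hlt hq]

variable [Fintype V]

/-- The sum `∑ r_s s` of a family of coefficients. -/
def combination (S : Set (PathAlgebra K V)) : (S →₀ PathAlgebra K V) →ₗ[PathAlgebra K V]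
    PathAlgebra K V :=
  Finsupp.linearCombination (PathAlgebra K V) (fun s : S => (s : PathAlgebra K V))

theorem combination_apply (r : S →₀ PathAlgebra K V) :
    combination S r = ∑ s ∈ r.support, r s * (s : PathAlgebra K V) := rfl

theorem combination_single (s : S) (x : PathAlgebra K V) :
    combination S (Finsupp.single s x) = x * s :=
  Finsupp.linearCombination_single _ _ _

/-- The coefficient of each `s` is contained in `R o(s)`, where `o(s)` is the vertex at which `s`
starts. -/
def IsComposable (lt : QPath V → QPath V → Prop) (r : S →₀ PathAlgebra K V) : Prop :=
  ∀ s : S, ∀ a ∈ (coeff (r s)).support, ∀ p, IsTip lt (s : PathAlgebra K V) p → a.target = p.source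

/-- The tips of the summands `r_s s` are pairwise distinct: a path with two terminal subpaths
`tip(s)` and `tip(s')` makes one of them a terminal subpath of the other, whence `s = s'`. So the
largest of these tips cannot cancel. -/
theorem IsTipBasis.exists_isTip_combination (hS : IsTipBasis lt S) (hlt : IsAdmissibleOrder lt)
    {r : S →₀ PathAlgebra K V} (hu : IsComposable lt r) (hr : r ≠ 0) :
    ∃ (s : S) (t q p : QPath V), IsTip lt (r s) t ∧ IsTip lt (s : PathAlgebra K V) q ∧
      QPath.concat t q = some p ∧ IsTip lt (combination S r) p := by
  classical
  have hex : ∀ s : S, ∃ x : QPath V × QPath V × QPath V, s ∈ r.support →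
      IsTip lt (r s) x.1 ∧ IsTip lt (s : PathAlgebra K V) x.2.1 ∧
        QPath.concat x.1 x.2.1 = some x.2.2 := by
    intro s
    obtain ⟨q, hq, -⟩ := hS.exists_tip s s.2
    by_cases hs : s ∈ r.support
    · obtain ⟨t, ht⟩ := exists_isTip hlt (Finsupp.mem_support_iff.1 hs)
      obtain ⟨p, hp⟩ := QPath.exists_concat (p := t) (q := q) (hu s t ht.1 q hq).symm
      exact ⟨(t, q, p), fun _ => ⟨ht, hq, hp⟩⟩
    · exact ⟨(q, q, q), fun h => absurd h hs⟩
  choose f hf using hex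
  obtain ⟨s₀, hs₀, hm⟩ := hlt.exists_max (Finsupp.support_nonempty_iff.2 hr) fun s => (f s).2.2
  obtain ⟨h₁, h₂, h₃⟩ := hf s₀ hs₀
  refine ⟨s₀, _, _, _, h₁, h₂, h₃, ?_⟩
  have htip : ∀ s (hs : s ∈ r.support), IsTip lt (r s * (s : PathAlgebra K V)) (f s).2.2 :=
    fun s hs => (hf s hs).1.mul_of_source hlt (hf s hs).2.1 (hf s hs).2.2
      (hS.source_eq hlt s.2 (hf s hs).2.1)
  rw [combination_apply, ← Finset.add_sum_erase _ _ hs₀]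
  refine ((htip s₀ hs₀).add_of_lt hlt fun b hb => ?_).1
  obtain ⟨s, hs, hb⟩ := mem_support_sum hb
  have hsr := Finset.mem_of_mem_erase hs
  have hne := Finset.ne_of_mem_erase hs
  have hlt₁ : lt (f s).2.2 (f s₀).2.2 := by
    refine (hm s hsr).resolve_left fun he => hne ?_
    have h := (hf s hsr).2.2
    rw [he] at h
    rcases QPath.isSuffix_or_isSuffix h h₃ with h | h
    · exact Subtype.ext (hS.eq_of_isSuffix _ s.2 _ s₀.2 _ _ (hf s hsr).2.1 h₂ h)
    · exact (Subtype.ext (hS.eq_of_isSuffix _ s₀.2 _ s.2 _ _ h₂ (hf s hsr).2.1 h)).symm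
  by_cases hbe : b = (f s).2.2
  · rwa [hbe]
  · exact hlt.trans ((htip s hsr).2 b hb hbe) hlt₁

theorem IsTipBasis.eq_zero_of_combination_eq_zero (hS : IsTipBasis lt S)
    (hlt : IsAdmissibleOrder lt) {r : S →₀ PathAlgebra K V} (hu : IsComposable lt r)
    (h : combination S r = 0) : r = 0 := by
  by_contra hr
  obtain ⟨s, t, q, p, -, -, -, hp⟩ := hS.exists_isTip_combination hlt hu hr
  exact hp.ne_zero h

/-- Right multiplication by the vertex discards the paths of `x` that cannot be followed by `s`; by
`IsTipBasis.mul_vertex_mul` this does not change the product with `s`. -/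
theorem isComposable_single (hlt : IsAdmissibleOrder lt)
    (s : S) (x : PathAlgebra K V) {q : QPath V} (hq : IsTip lt (s : PathAlgebra K V) q) :
    IsComposable lt (Finsupp.single s (x * ofPath K (QPath.vertex q.source))) := by
  classical
  intro s' a ha p hp
  by_cases h : s = s'
  · subst h
    rw [Finsupp.single_eq_same, Finsupp.mem_support_iff, coeff_mul_vertex] at ha
    rw [hp.unique hlt hq]
    by_contra hn
    exact ha (if_neg hn)
  · rw [Finsupp.single_eq_of_ne' h] at ha
    simp at ha

theorem IsComposable.add {r r' : S →₀ PathAlgebra K V} (h : IsComposable lt r)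
    (h' : IsComposable lt r') : IsComposable lt (r + r') := fun s a ha =>
  (mem_support_add ha).elim (h s a) (h' s a)

theorem isComposable_zero : IsComposable lt (0 : S →₀ PathAlgebra K V) := fun s a ha => by
  simp at ha

theorem IsComposable.smul {r : S →₀ PathAlgebra K V} (h : IsComposable lt r)
    (x : PathAlgebra K V) : IsComposable lt (x • r) := fun s a ha p hp => by
  obtain ⟨b, -, c, hc, hbc⟩ := mem_support_mul ha
  rw [(QPath.concat_eq_some hbc).2.2.1]
  exact h s c hc p hp

theorem IsTipBasis.mul_vertex_mul (hS : IsTipBasis lt S) (hlt : IsAdmissibleOrder lt)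
    (s : S) (x : PathAlgebra K V) {q : QPath V} (hq : IsTip lt (s : PathAlgebra K V) q) :
    x * ofPath K (QPath.vertex q.source) * (s : PathAlgebra K V) = x * s := by
  rw [mul_assoc, ofPath_vertex_mul_of_source (hS.source_eq hlt s.2 hq)]

/-- The ideal `𝔞` is kept general to treat `⨁ R s` (with `𝔞 = ⊤`) and `⨁ I s` together. -/
theorem IsTipBasis.exists_combination (hS : IsTipBasis lt S) (hlt : IsAdmissibleOrder lt)
    (𝔞 : Ideal (PathAlgebra K V)) [𝔞.IsTwoSided] {x : PathAlgebra K V}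
    (hx : x ∈ 𝔞 * Ideal.span S) :
    ∃ r : S →₀ PathAlgebra K V, IsComposable lt r ∧ (∀ s, r s ∈ 𝔞) ∧ combination S r = x := by
  classical
  -- The factor `i` stays universally quantified, so that a scalar `c` acting on `y` can be absorbed
  -- into `i * c`, which lies in `𝔞` because `𝔞` is two-sided.
  have key : ∀ y ∈ Ideal.span S, ∀ i ∈ 𝔞, ∃ r : S →₀ PathAlgebra K V, IsComposable lt r ∧
      (∀ s, r s ∈ 𝔞) ∧ combination S r = i * y := by
    intro y hy
    induction hy using Submodule.span_induction with
    | mem s hs =>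
      intro i hi
      obtain ⟨q, hq, -⟩ := hS.exists_tip s hs
      refine ⟨_, isComposable_single hlt ⟨s, hs⟩ i hq, fun s' => ?_, ?_⟩
      · rw [Finsupp.single_apply]
        split_ifs
        · exact 𝔞.mul_mem_right _ hi
        · exact 𝔞.zero_mem
      · rw [combination_single, hS.mul_vertex_mul hlt _ _ hq]
    | zero => exact fun i _ => ⟨0, isComposable_zero, fun _ => 𝔞.zero_mem, by simp⟩
    | add y z _ _ hy hz =>
      intro i hi
      obtain ⟨r, h₁, h₂, h₃⟩ := hy i hi
      obtain ⟨r', h₁', h₂', h₃'⟩ := hz i hi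
      exact ⟨r + r', h₁.add h₁', fun s => 𝔞.add_mem (h₂ s) (h₂' s), by
        rw [map_add, h₃, h₃', mul_add]⟩
    | smul c y _ hy =>
      intro i hi
      obtain ⟨r, h₁, h₂, h₃⟩ := hy (i * c) (𝔞.mul_mem_right _ hi)
      exact ⟨r, h₁, h₂, by rw [h₃, smul_eq_mul, mul_assoc]⟩
  refine Submodule.smul_induction_on hx (fun i hi y hy => key y hy i hi) ?_
  rintro y z ⟨r, h₁, h₂, h₃⟩ ⟨r', h₁', h₂', h₃'⟩
  exact ⟨r + r', h₁.add h₁', fun s => 𝔞.add_mem (h₂ s) (h₂' s), by rw [map_add, h₃, h₃']⟩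

theorem mem_top_mul {N : Ideal (PathAlgebra K V)} {x : PathAlgebra K V} :
    x ∈ (⊤ : Ideal (PathAlgebra K V)) * N ↔ x ∈ N :=
  ⟨fun h => Ideal.mul_le.2 (fun r _ _ hs => N.mul_mem_left r hs) h, fun h =>
    one_mul x ▸ Ideal.mul_mem_mul (Submodule.mem_top (x := 1)) h⟩

/-- The tips of `⨁ 𝔞 s`. -/
theorem IsTipBasis.tips_mul_span (hS : IsTipBasis lt S) (hlt : IsAdmissibleOrder lt)
    (𝔞 : Ideal (PathAlgebra K V)) [𝔞.IsTwoSided] :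
    tips lt ((𝔞 * Ideal.span S : Ideal (PathAlgebra K V)) : Set (PathAlgebra K V)) =
      {p | ∃ t ∈ tips lt (𝔞 : Set (PathAlgebra K V)), ∃ q ∈ tips lt S,
        QPath.concat t q = some p} := by
  refine Set.Subset.antisymm ?_ ?_
  · rintro p ⟨x, hx, hp⟩
    obtain ⟨r, h₁, h₂, rfl⟩ := hS.exists_combination hlt 𝔞 hx
    have hr : r ≠ 0 := by
      rintro rfl
      exact hp.ne_zero (map_zero _)
    obtain ⟨s, t, q, p', ht, hq, hc, hp'⟩ := hS.exists_isTip_combination hlt h₁ hr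
    rw [hp.unique hlt hp']
    exact ⟨t, ⟨_, h₂ s, ht⟩, q, ⟨_, s.2, hq⟩, hc⟩
  · rintro p ⟨t, ⟨x, hx, ht⟩, q, ⟨s, hs, hq⟩, hc⟩
    exact ⟨x * s, Ideal.mul_mem_mul hx (Ideal.subset_span hs),
      ht.mul_of_source hlt hq hc (hS.source_eq hlt hs hq)⟩

theorem IsTipBasis.tips_span (hS : IsTipBasis lt S) (hlt : IsAdmissibleOrder lt) :
    tips lt ((Ideal.span S : Ideal (PathAlgebra K V)) : Set (PathAlgebra K V)) =
      {p | ∃ t, ∃ q ∈ tips lt S, QPath.concat t q = some p} := by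
  have h := hS.tips_mul_span hlt ⊤
  have he : (⊤ : Ideal (PathAlgebra K V)) * Ideal.span S = Ideal.span S :=
    SetLike.ext fun x => mem_top_mul
  rw [he] at h
  rw [h]
  ext p
  constructor
  · rintro ⟨t, -, q, hq, hc⟩
    exact ⟨t, q, hq, hc⟩
  · rintro ⟨t, q, hq, hc⟩
    exact ⟨t, ⟨ofPath K t, trivial, isTip_ofPath t⟩, q, hq, hc⟩

end tipBasis

end PathAlgebra

namespace QPath

variable {V : Type u} [Quiver.{v} V]

theorem IsSuffix.eq_of_length {p q : QPath V} (h : IsSuffix p q) (hl : p.length = q.length) :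
    p = q := by
  obtain ⟨r, hr⟩ := h
  obtain ⟨hs, hq, -, hlen⟩ := concat_eq_some hr
  have h₀ := eq_vertex_of_length (p := r) (by omega)
  have ht : r.target = r.source := by rw [h₀]; rfl
  rw [h₀, ← ht, ← hs, vertex_source_concat] at hr
  exact Option.some.inj hr

end QPath

namespace PathAlgebra

/-! ### Two-sided ideals and the filtration by length. -/

section ideals

variable {K : Type w} [Field K] {V : Type u} [Quiver.{v} V] [Fintype V]

theorem mem_of_forall_ofPath_mem (N : Ideal (PathAlgebra K V)) {x : PathAlgebra K V}
    (h : ∀ p ∈ (coeff x).support, ofPath K p ∈ N) : x ∈ N := by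
  rw [← sum_coeff_smul x]
  exact N.sum_mem fun p hp => smul_mem_ideal N _ (h p hp)

theorem mem_genIdeal {X : Set (PathAlgebra K V)} {x : PathAlgebra K V} :
    x ∈ genIdeal X ↔ x ∈ TwoSidedIdeal.span X := by
  rw [genIdeal, TwoSidedIdeal.mem_asIdeal]

theorem subset_genIdeal (X : Set (PathAlgebra K V)) : X ⊆ genIdeal X := fun _ hx =>
  mem_genIdeal.2 (TwoSidedIdeal.subset_span hx)

theorem genIdeal_le {X : Set (PathAlgebra K V)} {N : Ideal (PathAlgebra K V)} [N.IsTwoSided]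
    (h : X ⊆ N) : genIdeal X ≤ N := by
  intro x hx
  rw [mem_genIdeal, TwoSidedIdeal.mem_span_iff] at hx
  have := hx N.toTwoSided fun y hy => by
    rw [SetLike.mem_coe, Ideal.mem_toTwoSided]
    exact h hy
  rwa [Ideal.mem_toTwoSided] at this

/-- The elements in which only paths with at least `n` arrows occur. -/
def lengthGE (K : Type w) [Field K] (V : Type u) [Quiver.{v} V] [Fintype V] (n : ℕ) :
    Ideal (PathAlgebra K V) where
  carrier := {x | ∀ p ∈ (coeff x).support, n ≤ p.length}
  zero_mem' := by simp
  add_mem' hx hy p hp := (mem_support_add hp).elim (hx p) (hy p)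
  smul_mem' c x hx p hp := by
    obtain ⟨a, -, b, hb, hab⟩ := mem_support_mul hp
    have := hx b hb
    rw [(QPath.concat_eq_some hab).2.2.2]
    omega

theorem ofPath_mem_lengthGE {n : ℕ} {p : QPath V} (h : n ≤ p.length) :
    ofPath K p ∈ lengthGE K V n := fun q hq => by
  rw [support_ofPath, Finset.mem_singleton] at hq
  rwa [hq]

instance (n : ℕ) : (lengthGE K V n).IsTwoSided :=
  ⟨fun {x} y hx p hp => by
    obtain ⟨a, ha, b, -, hab⟩ := mem_support_mul hp
    have := hx a ha
    rw [(QPath.concat_eq_some hab).2.2.2]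
    omega⟩

theorem arrowIdeal_eq : arrowIdeal K V = lengthGE K V 1 := by
  refine le_antisymm (genIdeal_le ?_) fun x hx => mem_of_forall_ofPath_mem _ fun p hp => ?_
  · rintro _ ⟨a, b, e, rfl⟩
    exact ofPath_mem_lengthGE le_rfl
  · obtain ⟨r, a, b, e, h⟩ := QPath.exists_concat_arrow (hx p hp)
    rw [← ofPath_mul_of_concat h]
    exact Ideal.mul_mem_left _ _ (subset_genIdeal _ ⟨a, b, e, rfl⟩)

theorem span_arrowSet : Ideal.span (arrowSet K V) = lengthGE K V 1 := by
  refine le_antisymm (Ideal.span_le.2 ?_) fun x hx => mem_of_forall_ofPath_mem _ fun p hp => ?_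
  · rintro _ ⟨a, b, e, rfl⟩
    exact ofPath_mem_lengthGE le_rfl
  · obtain ⟨r, a, b, e, h⟩ := QPath.exists_concat_arrow (hx p hp)
    rw [← ofPath_mul_of_concat h]
    exact Ideal.mul_mem_left _ _ (Ideal.subset_span ⟨a, b, e, rfl⟩)

theorem lengthGE_mul_le (m n : ℕ) : lengthGE K V m * lengthGE K V n ≤ lengthGE K V (m + n) :=
  Ideal.mul_le.2 fun x hx y hy p hp => by
    obtain ⟨a, ha, b, hb, hab⟩ := mem_support_mul hp
    have := hx a ha
    have := hy b hb
    rw [(QPath.concat_eq_some hab).2.2.2]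
    omega

theorem lengthGE_anti {m n : ℕ} (h : m ≤ n) : lengthGE K V n ≤ lengthGE K V m :=
  fun _ hx p hp => h.trans (hx p hp)

end ideals

/-! ### Homogeneous components and graded left ideals. -/

section components

variable {K : Type w} [Field K] {V : Type u} [Quiver.{v} V]

/-- The homogeneous component of degree `n`. -/
def component (n : ℕ) : PathAlgebra K V →ₗ[K] PathAlgebra K V where
  toFun x := (Finsupp.filter (fun p => p.length = n) (coeff x) : QPath V →₀ K)
  map_add' _ _ := Finsupp.filter_add
  map_smul' _ _ := Finsupp.filter_smul

theorem coeff_component (n : ℕ) (x : PathAlgebra K V) (p : QPath V) :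
    coeff (component n x) p = if p.length = n then coeff x p else 0 :=
  Finsupp.filter_apply _ _ _

theorem mem_support_component {n : ℕ} {x : PathAlgebra K V} {p : QPath V} :
    p ∈ (coeff (component n x)).support ↔ p.length = n ∧ p ∈ (coeff x).support := by
  simp [coeff_component]

theorem isHomogeneous_component (n : ℕ) (x : PathAlgebra K V) :
    IsHomogeneousOfDegree n (component n x) := fun _ hp => (mem_support_component.1 hp).1

theorem component_of_isHomogeneous {n : ℕ} {x : PathAlgebra K V} (h : IsHomogeneousOfDegree n x) :
    component n x = x := by
  ext p
  rw [coeff_component]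
  split_ifs with hp
  · rfl
  · exact (Finsupp.notMem_support_iff.1 fun h' => hp (h p h')).symm

theorem component_of_isHomogeneous_ne {m n : ℕ} {x : PathAlgebra K V}
    (h : IsHomogeneousOfDegree n x) (hmn : n ≠ m) : component m x = 0 := by
  ext p
  rw [coeff_component]
  split_ifs with hp
  · exact Finsupp.notMem_support_iff.1 fun h' => hmn ((h p h').symm.trans hp)
  · rfl

theorem isHomogeneous_ofPath (p : QPath V) : IsHomogeneousOfDegree p.length (ofPath K p) :=
  fun q hq => by
    rw [support_ofPath, Finset.mem_singleton] at hq
    rw [hq]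

theorem IsHomogeneousOfDegree.smul {n : ℕ} {x : PathAlgebra K V} (h : IsHomogeneousOfDegree n x)
    (c : K) : IsHomogeneousOfDegree n (c • x) := fun p hp => h p (mem_support_smul hp)

variable [Fintype V]

theorem IsHomogeneousOfDegree.mul {m n : ℕ} {x y : PathAlgebra K V}
    (hx : IsHomogeneousOfDegree m x) (hy : IsHomogeneousOfDegree n y) :
    IsHomogeneousOfDegree (m + n) (x * y) := fun p hp => by
  obtain ⟨a, ha, b, hb, hab⟩ := mem_support_mul hp
  rw [(QPath.concat_eq_some hab).2.2.2, hx a ha, hy b hb]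

theorem component_mul (n : ℕ) (x y : PathAlgebra K V) :
    component n (x * y) =
      ∑ kl ∈ Finset.HasAntidiagonal.antidiagonal n, component kl.1 x * component kl.2 y := by
  induction x using induction_on with
  | zero => simp
  | add x x' hx hx' => simp only [add_mul, map_add, hx, hx', Finset.sum_add_distrib]
  | smul c p =>
    induction y using induction_on with
    | zero => simp
    | add y y' hy hy' => simp only [mul_add, map_add, hy, hy', Finset.sum_add_distrib]
    | smul d q =>
      have hp := (isHomogeneous_ofPath (K := K) p).smul c
      have hq := (isHomogeneous_ofPath (K := K) q).smul d
      by_cases h : p.length + q.length = n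
      · rw [Finset.sum_eq_single (p.length, q.length), component_of_isHomogeneous hp,
          component_of_isHomogeneous hq, component_of_isHomogeneous (h ▸ hp.mul hq)]
        · rintro ⟨k, l⟩ hkl hne
          by_cases hk : p.length = k
          · by_cases hl : q.length = l
            · exact absurd (by rw [hk, hl]) hne
            · rw [component_of_isHomogeneous_ne hq hl, mul_zero]
          · rw [component_of_isHomogeneous_ne hp hk, zero_mul]
        · intro hn
          exact absurd (Finset.HasAntidiagonal.mem_antidiagonal.2 h) hn
      · rw [component_of_isHomogeneous_ne (hp.mul hq) h, Finset.sum_eq_zero]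
        rintro ⟨k, l⟩ hkl
        by_cases hk : p.length = k
        · rw [component_of_isHomogeneous_ne hq (m := l), mul_zero]
          rintro rfl
          exact h (by rw [hk]; exact Finset.HasAntidiagonal.mem_antidiagonal.1 hkl)
        · rw [component_of_isHomogeneous_ne hp hk, zero_mul]

theorem exists_sum_component (x : PathAlgebra K V) :
    ∃ n, ∑ i ∈ Finset.range n, component i x = x := by
  induction x using induction_on with
  | zero => exact ⟨0, rfl⟩
  | add x y hx hy =>
    have aux : ∀ (x : PathAlgebra K V) (m n : ℕ), m ≤ n →
        ∑ i ∈ Finset.range m, component i x = x → ∑ i ∈ Finset.range n, component i x = x := by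
      intro x m n hmn h
      have hz : ∀ i, m ≤ i → component i x = 0 := fun i hi => by
        rw [← h, map_sum]
        exact Finset.sum_eq_zero fun j hj => component_of_isHomogeneous_ne
          (isHomogeneous_component j x) (by have := Finset.mem_range.1 hj; omega)
      conv_rhs => rw [← h]
      refine (Finset.sum_subset (Finset.range_mono hmn) fun i _ hi => hz i ?_).symm
      simpa using hi
    obtain ⟨m, hm⟩ := hx
    obtain ⟨n, hn⟩ := hy
    refine ⟨max m n, ?_⟩
    simp only [map_add, Finset.sum_add_distrib]
    rw [aux x m _ (le_max_left _ _) hm, aux y n _ (le_max_right _ _) hn]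
  | smul c p =>
    refine ⟨p.length + 1, ?_⟩
    have hp := (isHomogeneous_ofPath (K := K) p).smul c
    rw [Finset.sum_eq_single p.length, component_of_isHomogeneous hp]
    · exact fun i _ hi => component_of_isHomogeneous_ne hp hi.symm
    · simp

/-- A left ideal containing the homogeneous components of its elements. -/
def IsGradedIdeal (N : Ideal (PathAlgebra K V)) : Prop :=
  ∀ x ∈ N, ∀ n, component n x ∈ N

theorem IsGradedIdeal.mul {M N : Ideal (PathAlgebra K V)} (hM : IsGradedIdeal M)
    (hN : IsGradedIdeal N) : IsGradedIdeal (M * N) := by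
  intro x hx n
  refine Submodule.smul_induction_on hx (fun a ha b hb => ?_) fun y z hy hz => ?_
  · rw [smul_eq_mul, component_mul]
    exact Ideal.sum_mem _ fun kl _ => Ideal.mul_mem_mul (hM a ha _) (hN b hb _)
  · rw [map_add]
    exact Ideal.add_mem _ hy hz

theorem IsGradedIdeal.inf {M N : Ideal (PathAlgebra K V)} (hM : IsGradedIdeal M)
    (hN : IsGradedIdeal N) : IsGradedIdeal (M ⊓ N) :=
  fun x hx n => ⟨hM x hx.1 n, hN x hx.2 n⟩

theorem isGradedIdeal_span {S : Set (PathAlgebra K V)}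
    (hS : ∀ s ∈ S, ∃ n, IsHomogeneousOfDegree n s) : IsGradedIdeal (Ideal.span S) := by
  intro x hx
  induction hx using Submodule.span_induction with
  | mem s hs =>
    intro n
    obtain ⟨m, hm⟩ := hS s hs
    by_cases h : m = n
    · rw [← h, component_of_isHomogeneous hm]; exact Ideal.subset_span hs
    · rw [component_of_isHomogeneous_ne hm h]; exact Ideal.zero_mem _
  | zero => intro n; rw [map_zero]; exact Ideal.zero_mem _
  | add y z _ _ hy hz => intro n; rw [map_add]; exact Ideal.add_mem _ (hy n) (hz n)
  | smul c y _ hy =>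
    intro n
    rw [smul_eq_mul, component_mul]
    exact Ideal.sum_mem _ fun kl _ => Ideal.mul_mem_left _ _ (hy _)

theorem isGradedIdeal_lengthGE (n : ℕ) : IsGradedIdeal (lengthGE K V n) :=
  fun _ hx _ p hp => hx p (mem_support_component.1 hp).2

/-- The largest graded left ideal contained in `N`. -/
def gradedCore (N : Ideal (PathAlgebra K V)) : Ideal (PathAlgebra K V) where
  carrier := {x | ∀ n, component n x ∈ N}
  zero_mem' n := by rw [map_zero]; exact N.zero_mem
  add_mem' hx hy n := by rw [map_add]; exact N.add_mem (hx n) (hy n)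
  smul_mem' c _ hx n := by
    rw [smul_eq_mul, component_mul]
    exact Ideal.sum_mem _ fun kl _ => Ideal.mul_mem_left _ _ (hx _)

instance (N : Ideal (PathAlgebra K V)) [N.IsTwoSided] : (gradedCore N).IsTwoSided :=
  ⟨fun {x} y hx n => by
    rw [component_mul]
    exact Ideal.sum_mem _ fun kl _ => Ideal.mul_mem_right _ _ (hx _)⟩

/-- The graded core of the ideal is two-sided and contains the homogeneous generators, so it is the
whole ideal. -/
theorem IsHomogeneousIdeal.isGradedIdeal {I : Ideal (PathAlgebra K V)}
    (hI : IsHomogeneousIdeal I) : IsGradedIdeal I := by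
  obtain ⟨X, hX, rfl⟩ := hI
  refine genIdeal_le (N := gradedCore (genIdeal X)) fun x hx n => ?_
  obtain ⟨m, hm⟩ := hX x hx
  by_cases h : m = n
  · rw [← h, component_of_isHomogeneous hm]; exact subset_genIdeal _ hx
  · rw [component_of_isHomogeneous_ne hm h]; exact Ideal.zero_mem _

end components

end PathAlgebra

namespace PathAlgebra

/-! ### Reduced left Groebner bases. -/

section reduced

variable {K : Type w} [Field K] {V : Type u} [Quiver.{v} V] {lt : QPath V → QPath V → Prop}

theorem IsTipBasis.mono {S S' : Set (PathAlgebra K V)} (hS : IsTipBasis lt S) (h : S' ⊆ S) :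
    IsTipBasis lt S' where
  exists_tip s hs := hS.exists_tip s (h hs)
  eq_of_isSuffix s hs s' hs' := hS.eq_of_isSuffix s (h hs) s' (h hs')

theorem isTipBasis_ofPath_image (hlt : IsAdmissibleOrder lt) {T : Set (QPath V)}
    (hT : ∀ p ∈ T, ∀ q ∈ T, QPath.IsSuffix p q → p = q) :
    IsTipBasis lt (ofPath K '' T) where
  exists_tip := by
    rintro _ ⟨p, -, rfl⟩
    refine ⟨p, isTip_ofPath p, fun b hb => ?_⟩
    rw [support_ofPath, Finset.mem_singleton] at hb
    rw [hb]
  eq_of_isSuffix := by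
    rintro _ ⟨p, hp, rfl⟩ _ ⟨q, hq, rfl⟩ p' q' hp' hq' hs
    rw [hp'.unique hlt (isTip_ofPath p), hq'.unique hlt (isTip_ofPath q)] at hs
    rw [hT p hp q hq hs]

variable [Fintype V]

/-- Both properties follow from reducedness. If a path `b` in `x` started elsewhere than the tip,
the product of its starting vertex with `x` would be an element of `N` whose tip occurs in `x` below
the tip. If two members have comparable tips, minimality makes the tips equal; the leading terms
cancel, and the tip of a nonzero difference would be a forbidden path in one of them. -/
theorem isTipBasis_reducedLeftGroebnerBasis (hlt : IsAdmissibleOrder lt)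
    (N : Ideal (PathAlgebra K V)) : IsTipBasis lt (reducedLeftGroebnerBasis lt N) where
  exists_tip := by
    classical
    rintro x ⟨hx, p, hp, -, -, hr⟩
    refine ⟨p, hp, fun b hb => ?_⟩
    by_contra hne
    have h0 : ofPath K (QPath.vertex b.source) * x ≠ 0 := fun h => by
      have := congrArg (fun y => coeff y b) h
      simp only [coeff_vertex_mul, if_true] at this
      exact Finsupp.mem_support_iff.1 hb this
    obtain ⟨q, hq⟩ := exists_isTip hlt h0
    have hqx := hq.1
    rw [Finsupp.mem_support_iff, coeff_vertex_mul] at hqx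
    split_ifs at hqx with hs
    · refine hr q (Finsupp.mem_support_iff.2 hqx) ?_ ⟨_, N.mul_mem_left _ hx, hq⟩
      rintro rfl
      exact hne hs.symm
    · exact hqx rfl
  eq_of_isSuffix := by
    rintro x ⟨hx, p₀, hp₀, hc, -, hr⟩ x' ⟨hx', p₀', hp₀', hc', hm', hr'⟩ p p' hp hp' hs
    obtain rfl := hp.unique hlt hp₀
    obtain rfl := hp'.unique hlt hp₀'
    obtain rfl := hm' p ⟨x, hx, hp⟩ hs
    by_contra hne
    obtain ⟨q, hq⟩ := exists_isTip hlt (sub_ne_zero.2 hne)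
    have hqN : q ∈ tips lt (N : Set (PathAlgebra K V)) := ⟨_, N.sub_mem hx hx', hq⟩
    have hqp : q ≠ p := by
      rintro rfl
      refine hq.coeff_ne_zero ?_
      rw [coeff_sub, Finsupp.sub_apply, hc, hc', sub_self]
    rcases mem_support_sub hq.1 with h | h
    · exact hr q h hqp hqN
    · exact hr' q h hqp hqN

/-- A further homogeneous component would lie in `N`, and its tip would be a path in `x`, other than
the tip of `x`, that is a tip of `N`. -/
theorem isHomogeneous_of_mem_reducedLeftGroebnerBasis (hlt : IsAdmissibleOrder lt)
    {N : Ideal (PathAlgebra K V)} (hN : IsGradedIdeal N) {x : PathAlgebra K V}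
    (hx : x ∈ reducedLeftGroebnerBasis lt N) : ∃ n, IsHomogeneousOfDegree n x := by
  obtain ⟨hx, p, hp, -, -, hr⟩ := hx
  refine ⟨p.length, fun b hb => ?_⟩
  by_contra hne
  have h0 : component b.length x ≠ 0 := fun h => by
    have hb' : b ∈ (coeff (component b.length x)).support := mem_support_component.2 ⟨rfl, hb⟩
    rw [h] at hb'
    simp at hb'
  obtain ⟨q, hq⟩ := exists_isTip hlt h0
  have hqx := mem_support_component.1 hq.1
  refine hr q hqx.2 ?_ ⟨_, hN x hx _, hq⟩
  rintro rfl
  exact hne hqx.1.symm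

theorem exists_mem_reducedLeftGroebnerBasis (hlt : IsAdmissibleOrder lt)
    {N : Ideal (PathAlgebra K V)} {p : QPath V}
    (hp : p ∈ tips lt (N : Set (PathAlgebra K V)))
    (hm : ∀ q ∈ tips lt (N : Set (PathAlgebra K V)), QPath.IsSuffix q p → q = p) :
    ∃ x ∈ reducedLeftGroebnerBasis lt N, IsTip lt x p := by
  obtain ⟨x, hx, hxp, hc, hr⟩ := exists_isTip_normal hlt (subspace N) hp
  exact ⟨x, ⟨hx, p, hxp, hc, hm, hr⟩, hxp⟩

end reduced

/-! ### The sets `f^n` and their tips. -/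

section ags

variable {K : Type w} [Field K] {V : Type u} [Quiver.{v} V] [Fintype V]
  {lt : QPath V → QPath V → Prop} {I : Ideal (PathAlgebra K V)}

/-- The left ideal `N^(n+2) = (⨁ R f^(n+1)_i) ∩ (⨁ I f^n_i)`. -/
def agsSyzygy (lt : QPath V → QPath V → Prop) (I : Ideal (PathAlgebra K V)) (n : ℕ) :
    Ideal (PathAlgebra K V) :=
  agsIdeal lt I (n + 1) ⊓ I * agsIdeal lt I n

theorem mem_agsSet {n : ℕ} {x : PathAlgebra K V} : x ∈ agsSet lt I (n + 2) ↔
    x ∈ reducedLeftGroebnerBasis lt (agsSyzygy lt I n) ∧ ∀ p, IsTip lt x p →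
      p ∉ tips lt ((I * agsIdeal lt I (n + 1) : Ideal (PathAlgebra K V)) :
        Set (PathAlgebra K V)) := by
  rw [agsSet]
  rfl

theorem agsSet_zero : agsSet lt I 0 = ofPath K '' Set.range QPath.vertex := by
  rw [agsSet]
  ext x
  constructor
  · rintro ⟨a, rfl⟩; exact ⟨_, ⟨a, rfl⟩, rfl⟩
  · rintro ⟨_, ⟨a, rfl⟩, rfl⟩; exact ⟨a, rfl⟩

theorem agsSet_one : agsSet lt I 1 = ofPath K '' {p : QPath V | p.length = 1} := by
  rw [agsSet]
  ext x
  constructor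
  · rintro ⟨a, b, e, rfl⟩; exact ⟨_, rfl, rfl⟩
  · rintro ⟨p, hp, rfl⟩
    obtain ⟨a, b, e, rfl⟩ := QPath.exists_eq_arrow hp
    exact ⟨a, b, e, rfl⟩

theorem agsIdeal_zero : agsIdeal lt I 0 = ⊤ := by
  rw [agsIdeal, agsSet]
  exact span_vertexSet

theorem agsIdeal_one : agsIdeal lt I 1 = lengthGE K V 1 := by
  rw [agsIdeal, agsSet]
  exact span_arrowSet

theorem isTipBasis_agsSet (hlt : IsAdmissibleOrder lt) : ∀ n, IsTipBasis lt (agsSet lt I n)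
  | 0 => by
    rw [agsSet_zero]
    refine isTipBasis_ofPath_image hlt ?_
    rintro _ ⟨a, rfl⟩ _ ⟨b, rfl⟩ h
    exact h.eq_of_length rfl
  | 1 => by
    rw [agsSet_one]
    exact isTipBasis_ofPath_image hlt fun p hp q hq h => h.eq_of_length (hp.trans hq.symm)
  | n + 2 => (isTipBasis_reducedLeftGroebnerBasis hlt (agsSyzygy lt I n)).mono
      fun _ hx => (mem_agsSet.1 hx).1

theorem isHomogeneous_of_mem_agsSet (hlt : IsAdmissibleOrder lt) (hI : IsGradedIdeal I) :
    ∀ n, ∀ x ∈ agsSet lt I n, ∃ d, IsHomogeneousOfDegree d x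
  | 0 => by
    rw [agsSet_zero]
    rintro _ ⟨p, -, rfl⟩
    exact ⟨_, isHomogeneous_ofPath p⟩
  | 1 => by
    rw [agsSet_one]
    rintro _ ⟨p, -, rfl⟩
    exact ⟨_, isHomogeneous_ofPath p⟩
  | n + 2 => fun x hx => isHomogeneous_of_mem_reducedLeftGroebnerBasis hlt
      ((isGradedIdeal_span (isHomogeneous_of_mem_agsSet hlt hI (n + 1))).inf
        (hI.mul (isGradedIdeal_span (isHomogeneous_of_mem_agsSet hlt hI n))))
      (mem_agsSet.1 hx).1

theorem isGradedIdeal_agsIdeal (hlt : IsAdmissibleOrder lt) (hI : IsGradedIdeal I) (n : ℕ) :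
    IsGradedIdeal (agsIdeal lt I n) :=
  isGradedIdeal_span (isHomogeneous_of_mem_agsSet hlt hI n)

theorem mul_agsIdeal_le_agsSyzygy (n : ℕ) :
    I * agsIdeal lt I (n + 1) ≤ agsSyzygy lt I n :=
  Ideal.mul_le.2 fun r hr _ hs => ⟨Ideal.mul_mem_left _ r hs,
    Ideal.mul_mem_mul hr (agsIdeal_succ_le lt I n hs)⟩

theorem agsIdeal_le_agsSyzygy (n : ℕ) : agsIdeal lt I (n + 2) ≤ agsSyzygy lt I n :=
  Ideal.span_le.2 fun _ hx => (mem_agsSet.1 hx).1.1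

/-- The right-hand side refers only to tip sets of two left ideals; the coefficients of the elements
of `f^(n+2)` have disappeared. This is what makes a comparison of different ideals `I` possible. -/
theorem mem_tips_agsSet (hlt : IsAdmissibleOrder lt) {n : ℕ} {p : QPath V} :
    p ∈ tips lt (agsSet lt I (n + 2)) ↔
      (p ∈ tips lt (agsSyzygy lt I n : Set (PathAlgebra K V)) ∧
        ∀ q ∈ tips lt (agsSyzygy lt I n : Set (PathAlgebra K V)), QPath.IsSuffix q p → q = p) ∧
      p ∉ tips lt ((I * agsIdeal lt I (n + 1) : Ideal (PathAlgebra K V)) :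
        Set (PathAlgebra K V)) := by
  constructor
  · rintro ⟨x, hx, hp⟩
    obtain ⟨⟨hxN, p', hp', -, hm, -⟩, hn⟩ := mem_agsSet.1 hx
    obtain rfl := hp.unique hlt hp'
    exact ⟨⟨⟨x, hxN, hp⟩, hm⟩, hn p hp⟩
  · rintro ⟨⟨hp, hm⟩, hn⟩
    obtain ⟨x, hx, hxp⟩ := exists_mem_reducedLeftGroebnerBasis hlt hp hm
    exact ⟨x, mem_agsSet.2 ⟨hx, fun q hq => hq.unique hlt hxp ▸ hn⟩, hxp⟩

/-- Pass to a minimal terminal subpath that is a tip of `N^(n+2)`: either it is a tip of `⨁ I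
f^(n+1)_i` or it is the tip of a member of `f^(n+2)`. Both alternatives are stable under extension
on the left. -/
theorem tips_agsSyzygy_subset (hlt : IsAdmissibleOrder lt) (n : ℕ) :
    tips lt (agsSyzygy lt I n : Set (PathAlgebra K V)) ⊆
      tips lt (agsIdeal lt I (n + 2) : Set (PathAlgebra K V)) ∪
        tips lt ((I * agsIdeal lt I (n + 1) : Ideal (PathAlgebra K V)) :
          Set (PathAlgebra K V)) := by
  intro p hp
  obtain ⟨q, hq, ⟨r, hr⟩, hm⟩ := hlt.exists_minimal_suffix _ hp
  by_cases h : q ∈ tips lt ((I * agsIdeal lt I (n + 1) : Ideal (PathAlgebra K V)) :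
      Set (PathAlgebra K V))
  · exact Or.inr (concat_mem_tips hlt h hr)
  · obtain ⟨x, hx, hxq⟩ := (mem_tips_agsSet hlt).2 ⟨⟨hq, hm⟩, h⟩
    exact Or.inl (concat_mem_tips hlt ⟨x, Ideal.subset_span hx, hxq⟩ hr)

/-- `N^(n+2) = ⨁ R f^(n+2)_i + ⨁ I f^(n+1)_i`. -/
theorem exists_add_of_mem_agsSyzygy (hlt : IsAdmissibleOrder lt) {n : ℕ} {x : PathAlgebra K V}
    (hx : x ∈ agsSyzygy lt I n) :
    ∃ y ∈ agsIdeal lt I (n + 2), ∃ z ∈ I * agsIdeal lt I (n + 1), x = y + z := by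
  obtain ⟨y, hy, z, hz, h, -⟩ := exists_add_of_tips_subset hlt (A := subspace (agsIdeal lt I (n + 2)))
    (B := subspace (I * agsIdeal lt I (n + 1))) (N := subspace (agsSyzygy lt I n))
    (agsIdeal_le_agsSyzygy n) (mul_agsIdeal_le_agsSyzygy n) (tips_agsSyzygy_subset hlt n) hx
  exact ⟨y, hy, z, hz, h⟩

theorem mul_agsIdeal_zero_le [I.IsTwoSided] : I * agsIdeal lt I 0 ≤ I :=
  Ideal.mul_le.2 fun _ hr s _ => I.mul_mem_right s hr

/-- For `n = 0` the intersection is just `I A^0`, since `I A^0 ⊆ I ⊆ J = A^1`. Afterwards both left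
ideals lie in the preceding syzygy ideal, where division is available. -/
theorem tips_agsSyzygy [I.IsTwoSided] (hlt : IsAdmissibleOrder lt) (hI : I ≤ lengthGE K V 1) :
    ∀ n, tips lt (agsSyzygy lt I n : Set (PathAlgebra K V)) =
      tips lt (agsIdeal lt I (n + 1) : Set (PathAlgebra K V)) ∩
        tips lt ((I * agsIdeal lt I n : Ideal (PathAlgebra K V)) : Set (PathAlgebra K V))
  | 0 => by
    have h : agsSyzygy lt I 0 = I * agsIdeal lt I 0 :=
      inf_eq_right.2 (mul_agsIdeal_zero_le.trans (hI.trans agsIdeal_one.ge))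
    rw [h]
    refine (Set.inter_eq_right.2 ?_).symm
    rintro p ⟨x, hx, hp⟩
    exact ⟨x, agsIdeal_one.ge (hI (mul_agsIdeal_zero_le hx)), hp⟩
  | n + 1 => tips_inf hlt (A := subspace (agsIdeal lt I (n + 2)))
      (B := subspace (I * agsIdeal lt I (n + 1))) (N := subspace (agsSyzygy lt I n))
      (agsIdeal_le_agsSyzygy n) (mul_agsIdeal_le_agsSyzygy n) (tips_agsSyzygy_subset hlt n)

theorem tips_agsIdeal (hlt : IsAdmissibleOrder lt) (n : ℕ) :
    tips lt (agsIdeal lt I n : Set (PathAlgebra K V)) =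
      {p | ∃ t, ∃ q ∈ tips lt (agsSet lt I n), QPath.concat t q = some p} :=
  (isTipBasis_agsSet hlt n).tips_span hlt

theorem tips_mul_agsIdeal (hlt : IsAdmissibleOrder lt) (𝔞 : Ideal (PathAlgebra K V))
    [𝔞.IsTwoSided] (n : ℕ) :
    tips lt ((𝔞 * agsIdeal lt I n : Ideal (PathAlgebra K V)) : Set (PathAlgebra K V)) =
      {p | ∃ t ∈ tips lt (𝔞 : Set (PathAlgebra K V)), ∃ q ∈ tips lt (agsSet lt I n),
        QPath.concat t q = some p} :=
  (isTipBasis_agsSet hlt n).tips_mul_span hlt 𝔞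

/-- The tips of the elements of `f^n` depend on the tips of the elements of `I` only. -/
theorem tips_agsSet_congr (hlt : IsAdmissibleOrder lt) {I' : Ideal (PathAlgebra K V)}
    [I.IsTwoSided] [I'.IsTwoSided] (hI : I ≤ lengthGE K V 1) (hI' : I' ≤ lengthGE K V 1)
    (h : tips lt (I : Set (PathAlgebra K V)) = tips lt (I' : Set (PathAlgebra K V))) :
    ∀ n, tips lt (agsSet lt I n) = tips lt (agsSet lt I' n)
  | 0 => by rw [agsSet_zero, agsSet_zero]
  | 1 => by rw [agsSet_one, agsSet_one]
  | n + 2 => by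
    have h₀ := tips_agsSet_congr hlt hI hI' h n
    have h₁ := tips_agsSet_congr hlt hI hI' h (n + 1)
    have hm : ∀ m, tips lt (agsSet lt I m) = tips lt (agsSet lt I' m) →
        tips lt ((I * agsIdeal lt I m : Ideal (PathAlgebra K V)) : Set (PathAlgebra K V)) =
          tips lt ((I' * agsIdeal lt I' m : Ideal (PathAlgebra K V)) :
            Set (PathAlgebra K V)) := fun m hm => by
      rw [tips_mul_agsIdeal hlt, tips_mul_agsIdeal hlt, h, hm]
    have hN : tips lt (agsSyzygy lt I n : Set (PathAlgebra K V)) =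
        tips lt (agsSyzygy lt I' n : Set (PathAlgebra K V)) := by
      rw [tips_agsSyzygy hlt hI, tips_agsSyzygy hlt hI', hm n h₀, tips_agsIdeal hlt,
        tips_agsIdeal hlt, h₁]
    ext p
    rw [mem_tips_agsSet hlt, mem_tips_agsSet hlt, hN, hm (n + 1) h₁]

/-- No element of `f^n` is contained in `⨁ J f^n_i`. -/
theorem notMem_lengthGE_mul_agsIdeal (hlt : IsAdmissibleOrder lt) {n : ℕ} {x : PathAlgebra K V}
    (hx : x ∈ agsSet lt I n) : x ∉ lengthGE K V 1 * agsIdeal lt I n := by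
  intro h
  have hS := isTipBasis_agsSet (I := I) hlt n
  obtain ⟨p, hp, -⟩ := hS.exists_tip x hx
  have hp' : p ∈ tips lt ((lengthGE K V 1 * agsIdeal lt I n : Ideal (PathAlgebra K V)) :
      Set (PathAlgebra K V)) := ⟨x, h, hp⟩
  rw [tips_mul_agsIdeal hlt] at hp'
  obtain ⟨t, ⟨y, hy, ht⟩, q, ⟨z, hz, hq⟩, hc⟩ := hp'
  -- The tip `q` of `z` is a terminal subpath of the tip `p` of `x`, so `z = x` and `q = p`. This
  -- contradicts `p = t q` with `t` of positive length.
  obtain rfl := hS.eq_of_isSuffix z hz x hx q p hq hp ⟨t, hc⟩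
  obtain rfl := hp.unique hlt hq
  have h₁ := hy t ht.1
  have h₂ := (QPath.concat_eq_some hc).2.2.2
  omega

end ags

end PathAlgebra

namespace PathAlgebra

/-! ### Monomial ideals and the ideal spanned by `tip(I)`. -/

section monomial

variable {K : Type w} [Field K] {V : Type u} [Quiver.{v} V] [Fintype V]
  {lt : QPath V → QPath V → Prop} {I : Ideal (PathAlgebra K V)}

/-- A left ideal containing all paths which occur in its elements. -/
def IsMonomialIdeal (N : Ideal (PathAlgebra K V)) : Prop :=
  ∀ x ∈ N, ∀ p ∈ (coeff x).support, ofPath K p ∈ N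

theorem IsMonomialIdeal.isGradedIdeal {N : Ideal (PathAlgebra K V)} (hN : IsMonomialIdeal N) :
    IsGradedIdeal N := fun x hx _ => mem_of_forall_ofPath_mem N fun p hp =>
  hN x hx p (mem_support_component.1 hp).2

theorem IsMonomialIdeal.inf {M N : Ideal (PathAlgebra K V)} (hM : IsMonomialIdeal M)
    (hN : IsMonomialIdeal N) : IsMonomialIdeal (M ⊓ N) :=
  fun x hx p hp => ⟨hM x hx.1 p hp, hN x hx.2 p hp⟩

theorem IsMonomialIdeal.mul {M N : Ideal (PathAlgebra K V)} (hM : IsMonomialIdeal M)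
    (hN : IsMonomialIdeal N) : IsMonomialIdeal (M * N) := by
  intro x hx
  refine Submodule.smul_induction_on hx (fun a ha b hb p hp => ?_) fun y z hy hz p hp => ?_
  · obtain ⟨c, hc, d, hd, hcd⟩ := mem_support_mul hp
    rw [← ofPath_mul_of_concat hcd]
    exact Ideal.mul_mem_mul (hM a ha c hc) (hN b hb d hd)
  · exact (mem_support_add hp).elim (hy p) (hz p)

theorem isMonomialIdeal_span {S : Set (PathAlgebra K V)} (hS : S ⊆ Set.range (ofPath K)) :
    IsMonomialIdeal (Ideal.span S) := by
  intro x hx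
  induction hx using Submodule.span_induction with
  | mem s hs =>
    intro p hp
    obtain ⟨q, rfl⟩ := hS hs
    rw [support_ofPath, Finset.mem_singleton] at hp
    rw [hp]
    exact Ideal.subset_span hs
  | zero => intro p hp; simp at hp
  | add y z _ _ hy hz => exact fun p hp => (mem_support_add hp).elim (hy p) (hz p)
  | smul c y _ hy =>
    intro p hp
    obtain ⟨a, -, b, hb, hab⟩ := mem_support_mul hp
    rw [← ofPath_mul_of_concat hab]
    exact Ideal.mul_mem_left _ _ (hy b hb)

/-- All paths occurring in an element of a monomial ideal are tips of that ideal, so reducedness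
leaves only the leading one. -/
theorem reducedLeftGroebnerBasis_subset {N : Ideal (PathAlgebra K V)} (hN : IsMonomialIdeal N) :
    reducedLeftGroebnerBasis lt N ⊆ Set.range (ofPath K) := by
  rintro x ⟨hx, p, hp, hc, -, hr⟩
  have hs : (coeff x).support = {p} := by
    ext q
    rw [Finset.mem_singleton]
    constructor
    · intro hq
      by_contra hne
      exact hr q hq hne ⟨_, hN x hx q hq, isTip_ofPath q⟩
    · rintro rfl; exact hp.1
  refine ⟨p, ?_⟩
  rw [← sum_coeff_smul x, hs, Finset.sum_singleton, hc, one_smul]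

theorem agsSet_subset_range (hI : IsMonomialIdeal I) :
    ∀ n, agsSet lt I n ⊆ Set.range (ofPath K)
  | 0 => by rw [agsSet_zero]; exact Set.image_subset_range _ _
  | 1 => by rw [agsSet_one]; exact Set.image_subset_range _ _
  | n + 2 => fun _ hx => reducedLeftGroebnerBasis_subset
      ((isMonomialIdeal_span (agsSet_subset_range hI (n + 1))).inf
        (hI.mul (isMonomialIdeal_span (agsSet_subset_range hI n)))) (mem_agsSet.1 hx).1

/-- In the low cases lengths differ: `0` and `1`, then `1` and at least `2` because `I ⊆ J^2`. From
then on, elements of `f^(n+3)` lie in `⨁ I f^(n+1)_i`, whose tips are excluded from the tips of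
`f^(n+2)` by construction. -/
theorem tips_agsSet_disjoint (hlt : IsAdmissibleOrder lt) [I.IsTwoSided]
    (hI : I ≤ lengthGE K V 2) {p : QPath V} :
    ∀ n, p ∈ tips lt (agsSet lt I (n + 1)) → p ∉ tips lt (agsSet lt I n)
  | 0 => by
    rw [agsSet_zero, agsSet_one]
    rintro ⟨_, ⟨q, hq, rfl⟩, hp⟩ ⟨_, ⟨_, ⟨a, rfl⟩, rfl⟩, hp'⟩
    rw [hp.unique hlt (isTip_ofPath q)] at hp'
    rw [hp'.unique hlt (isTip_ofPath _)] at hq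
    exact absurd hq (by simp [QPath.length_vertex])
  | 1 => by
    rw [agsSet_one]
    rintro ⟨x, hx, hp⟩ ⟨_, ⟨q, hq, rfl⟩, hp'⟩
    have h₂ := hI (mul_agsIdeal_zero_le ((mem_agsSet.1 hx).1.1).2) p hp.1
    rw [hp'.unique hlt (isTip_ofPath q), show q.length = 1 from hq] at h₂
    omega
  | n + 2 => by
    rintro ⟨x, hx, hp⟩ ⟨y, hy, hp'⟩
    exact (mem_agsSet.1 hy).2 p hp' ⟨x, (mem_agsSet.1 hx).1.1.2, hp⟩

/-- A path in `f^(n+1)` has the form `t q` with `q ∈ f^n`. If `t` had length `0`, this path would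
belong to both sets, contrary to `tips_agsSet_disjoint`. This is the minimality of the resolution in
the monomial case. -/
theorem agsIdeal_succ_le_lengthGE_mul (hlt : IsAdmissibleOrder lt) [I.IsTwoSided]
    (hI : I ≤ lengthGE K V 2) (hm : IsMonomialIdeal I) (n : ℕ) :
    agsIdeal lt I (n + 1) ≤ lengthGE K V 1 * agsIdeal lt I n := by
  refine Ideal.span_le.2 fun x hx => ?_
  obtain ⟨p, rfl⟩ := agsSet_subset_range hm (n + 1) hx
  have hp : p ∈ tips lt (agsIdeal lt I n : Set (PathAlgebra K V)) :=
    ⟨_, agsIdeal_succ_le lt I n (Ideal.subset_span hx), isTip_ofPath p⟩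
  rw [tips_agsIdeal hlt] at hp
  obtain ⟨t, q, ⟨y, hy, hq⟩, hc⟩ := hp
  obtain ⟨q', rfl⟩ := agsSet_subset_range hm n hy
  obtain rfl := hq.unique hlt (isTip_ofPath q')
  rw [← ofPath_mul_of_concat hc]
  refine Ideal.mul_mem_mul (ofPath_mem_lengthGE (Nat.one_le_iff_ne_zero.2 fun h => ?_))
    (Ideal.subset_span hy)
  have hl := (QPath.concat_eq_some hc).2.2.2
  obtain rfl := QPath.IsSuffix.eq_of_length ⟨t, hc⟩ (by omega)
  exact tips_agsSet_disjoint hlt hI n ⟨_, hx, isTip_ofPath q⟩ ⟨_, hy, isTip_ofPath q⟩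

/-- The elements in which only paths of `tip(I)` occur. -/
def tipIdeal (hlt : IsAdmissibleOrder lt) (I : Ideal (PathAlgebra K V)) :
    Ideal (PathAlgebra K V) where
  carrier := {x | ∀ p ∈ (coeff x).support, p ∈ tips lt (I : Set (PathAlgebra K V))}
  zero_mem' := by simp
  add_mem' hx hy p hp := (mem_support_add hp).elim (hx p) (hy p)
  smul_mem' c x hx p hp := by
    obtain ⟨a, -, b, hb, hab⟩ := mem_support_mul hp
    exact concat_mem_tips hlt (hx b hb) hab

instance (hlt : IsAdmissibleOrder lt) (I : Ideal (PathAlgebra K V)) [I.IsTwoSided] :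
    (tipIdeal hlt I).IsTwoSided :=
  ⟨fun {x} y hx p hp => by
    obtain ⟨a, ha, b, -, hab⟩ := mem_support_mul hp
    exact concat_mem_tips_right hlt (hx a ha) hab⟩

theorem ofPath_mem_tipIdeal {hlt : IsAdmissibleOrder lt} {p : QPath V}
    (hp : p ∈ tips lt (I : Set (PathAlgebra K V))) : ofPath K p ∈ tipIdeal hlt I := fun q hq => by
  rw [support_ofPath, Finset.mem_singleton] at hq
  rwa [hq]

theorem isMonomialIdeal_tipIdeal (hlt : IsAdmissibleOrder lt) (I : Ideal (PathAlgebra K V)) :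
    IsMonomialIdeal (tipIdeal hlt I) := fun _ hx p hp => ofPath_mem_tipIdeal (hx p hp)

theorem tips_tipIdeal (hlt : IsAdmissibleOrder lt) (I : Ideal (PathAlgebra K V)) :
    tips lt (tipIdeal hlt I : Set (PathAlgebra K V)) = tips lt (I : Set (PathAlgebra K V)) := by
  ext p
  constructor
  · rintro ⟨x, hx, hp⟩
    exact hx p hp.1
  · exact fun hp => ⟨_, ofPath_mem_tipIdeal hp, isTip_ofPath p⟩

theorem tipIdeal_le_lengthGE (hlt : IsAdmissibleOrder lt) {n : ℕ} (hI : I ≤ lengthGE K V n) :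
    tipIdeal hlt I ≤ lengthGE K V n := fun _ hx p hp => by
  obtain ⟨y, hy, hyp⟩ := hx p hp
  exact hI hy p hyp.1

theorem monomialIdeal_eq_tipIdeal (hlt : IsAdmissibleOrder lt) [I.IsTwoSided]
    {G : Set (PathAlgebra K V)} (hG : IsReducedGroebnerBasis lt I G) :
    monomialIdeal lt G = tipIdeal hlt I := by
  rw [monomialIdeal, hG.span_tips]
  refine le_antisymm (genIdeal_le ?_) fun x hx => mem_of_forall_ofPath_mem _ fun p hp =>
    subset_genIdeal _ ⟨p, hx p hp, rfl⟩
  rintro _ ⟨p, hp, rfl⟩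
  exact ofPath_mem_tipIdeal hp

end monomial

end PathAlgebra

/-! ### Passage from modules over a ring to modules over a quotient. -/

section quotient

variable {R : Type*} [Ring R] {I : Ideal R} [I.IsTwoSided]

theorem mk_smul_eq_smul {M : Type*} [AddCommGroup M] [Module R M] [Module (R ⧸ I) M]
    [IsScalarTower R (R ⧸ I) M] (r : R) (x : M) : Ideal.Quotient.mk I r • x = r • x := by
  have hr : Ideal.Quotient.mk I r = r • (1 : R ⧸ I) := by
    rw [← map_one (Ideal.Quotient.mk I)]
    change _ = Ideal.Quotient.mk I (r * 1)
    rw [mul_one]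
  rw [hr, smul_assoc, one_smul]

/-- An `R`-linear map between `R ⧸ I`-modules is `R ⧸ I`-linear. -/
def LinearMap.extendQuotient {M N : Type*} [AddCommGroup M] [AddCommGroup N] [Module R M]
    [Module R N] [Module (R ⧸ I) M] [Module (R ⧸ I) N] [IsScalarTower R (R ⧸ I) M]
    [IsScalarTower R (R ⧸ I) N] (f : M →ₗ[R] N) : M →ₗ[R ⧸ I] N where
  toFun := f
  map_add' := map_add f
  map_smul' := by
    intro r x
    obtain ⟨r, rfl⟩ := Ideal.Quotient.mk_surjective r
    rw [RingHom.id_apply, mk_smul_eq_smul, mk_smul_eq_smul, map_smul]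

/-- A section is obtained by lifting the projection from `P`; the lift kills `I P` because its
target is annihilated by `I`. -/
theorem projective_quotient_smul_top (P : Type*) [AddCommGroup P] [Module R P]
    [Module.Projective R P] : Module.Projective (R ⧸ I) (P ⧸ I • (⊤ : Submodule R P)) := by
  refine Module.Projective.of_lifting_property'' fun f hf => ?_
  obtain ⟨h, hh⟩ := Module.projective_lifting_property (f.restrictScalars R)
    (Submodule.mkQ (I • (⊤ : Submodule R P))) hf
  have hI : I • (⊤ : Submodule R P) ≤ LinearMap.ker h := Submodule.smul_le.2 fun r hr x _ => by
    rw [LinearMap.mem_ker, map_smul, ← mk_smul_eq_smul (I := I),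
      Ideal.Quotient.eq_zero_iff_mem.2 hr, zero_smul]
  refine ⟨(Submodule.liftQ _ h hI).extendQuotient, LinearMap.ext fun x => ?_⟩
  obtain ⟨x, rfl⟩ := Submodule.Quotient.mk_surjective _ x
  exact LinearMap.congr_fun hh x

end quotient

namespace PathAlgebra

/-! ### Projectivity of `⨁ R s`. -/

section projective

variable {K : Type w} [Field K] {V : Type u} [Quiver.{v} V] [Fintype V]
  {lt : QPath V → QPath V → Prop} {S : Set (PathAlgebra K V)}

/-- Composable coefficients are unique, hence linear in the element, and split the surjection from
the free module on `S`. -/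
theorem IsTipBasis.projective (hS : IsTipBasis lt S) (hlt : IsAdmissibleOrder lt) :
    Module.Projective (PathAlgebra K V) (Ideal.span S) := by
  have hex : ∀ x : Ideal.span S, ∃ r : S →₀ PathAlgebra K V, IsComposable lt r ∧
      combination S r = x := fun x => by
    obtain ⟨r, h₁, -, h₂⟩ := hS.exists_combination hlt ⊤ (mem_top_mul.2 x.2)
    exact ⟨r, h₁, h₂⟩
  choose f hf₁ hf₂ using hex
  have huniq : ∀ (x : Ideal.span S) r, IsComposable lt r →
      combination S r = (x : PathAlgebra K V) → f x = r := by
    intro x r h₁ h₂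
    refine sub_eq_zero.1 (hS.eq_zero_of_combination_eq_zero hlt (r := f x - r) ?_ ?_)
    · rw [sub_eq_add_neg, ← neg_one_smul (PathAlgebra K V) r]
      exact (hf₁ x).add (h₁.smul _)
    · rw [map_sub, hf₂, h₂, sub_self]
  have hmem : ∀ r, combination S r ∈ Ideal.span S := fun r => by
    rw [combination_apply]
    exact Ideal.sum_mem _ fun s _ => Ideal.mul_mem_left _ _ (Ideal.subset_span s.2)
  refine Module.Projective.of_split
    (i := { toFun := f
            map_add' := fun x y => huniq _ _ ((hf₁ x).add (hf₁ y)) (by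
              rw [map_add, hf₂, hf₂]; rfl)
            map_smul' := fun c x => huniq _ _ ((hf₁ x).smul c) (by
              rw [map_smul, hf₂]; rfl) })
    (s := (combination S).codRestrict (Ideal.span S) hmem) ?_
  exact LinearMap.ext fun x => Subtype.ext (hf₂ x)

end projective

/-! ### The AGS complex as a graded projective resolution. -/

section agsModule

variable {K : Type w} [Field K] {V : Type u} [Quiver.{v} V] [Fintype V]
  {lt : QPath V → QPath V → Prop} {I : Ideal (PathAlgebra K V)}

/-- The class of an element of `⨁ R f^n_i`. -/
def agsMk {n : ℕ} (x : PathAlgebra K V) (hx : x ∈ agsIdeal lt I n) : AGSModule lt I n :=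
  Submodule.Quotient.mk ⟨x, hx⟩

theorem exists_agsMk {n : ℕ} (m : AGSModule lt I n) :
    ∃ (x : PathAlgebra K V) (hx : x ∈ agsIdeal lt I n), agsMk x hx = m := by
  obtain ⟨⟨x, hx⟩, rfl⟩ := Submodule.Quotient.mk_surjective _ m
  exact ⟨x, hx, rfl⟩

theorem agsMk_eq_zero {n : ℕ} {x : PathAlgebra K V} {hx : x ∈ agsIdeal lt I n} :
    agsMk x hx = 0 ↔ x ∈ I * agsIdeal lt I n :=
  (Submodule.Quotient.mk_eq_zero _).trans (Submodule.mem_smul_top_iff I (agsIdeal lt I n) ⟨x, hx⟩)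

theorem agsMk_eq_agsMk {n : ℕ} {x y : PathAlgebra K V} {hx : x ∈ agsIdeal lt I n}
    {hy : y ∈ agsIdeal lt I n} : agsMk x hx = agsMk y hy ↔ x - y ∈ I * agsIdeal lt I n := by
  rw [← agsMk_eq_zero (hx := Submodule.sub_mem _ hx hy), ← sub_eq_zero]
  rfl

theorem agsMk_add {n : ℕ} {x y : PathAlgebra K V} (hx : x ∈ agsIdeal lt I n)
    (hy : y ∈ agsIdeal lt I n) :
    agsMk (x + y) (Submodule.add_mem _ hx hy) = agsMk x hx + agsMk y hy := rfl

theorem agsMk_sum {n : ℕ} {ι : Type*} (s : Finset ι) (f : ι → PathAlgebra K V)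
    (hf : ∀ i, f i ∈ agsIdeal lt I n) :
    agsMk (∑ i ∈ s, f i) (Submodule.sum_mem _ fun i _ => hf i) = ∑ i ∈ s, agsMk (f i) (hf i) := by
  classical
  induction s using Finset.induction_on with
  | empty => simp only [Finset.sum_empty]; rfl
  | insert a s ha ih =>
    simp only [Finset.sum_insert ha]
    rw [← ih]
    rfl

variable (lt I) in
/-- The homogeneous components of `Q^n`. -/
def agsGr (n : ℕ) (i : ℤ) : AddSubgroup (AGSModule lt I n) where
  carrier := {m | ∃ (x : PathAlgebra K V) (hx : x ∈ agsIdeal lt I n),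
    (∀ p ∈ (coeff x).support, (p.length : ℤ) = i) ∧ agsMk x hx = m}
  zero_mem' := ⟨0, Submodule.zero_mem _, by simp, rfl⟩
  add_mem' := by
    rintro _ _ ⟨x, hx, hxi, rfl⟩ ⟨y, hy, hyi, rfl⟩
    exact ⟨x + y, Submodule.add_mem _ hx hy, fun p hp => (mem_support_add hp).elim (hxi p) (hyi p),
      rfl⟩
  neg_mem' := by
    rintro _ ⟨x, hx, hxi, rfl⟩
    refine ⟨-x, Submodule.neg_mem _ hx, fun p hp => hxi p ?_, rfl⟩
    rw [← neg_one_smul K x] at hp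
    exact mem_support_smul hp

theorem component_of_forall_length {i : ℤ} {x : PathAlgebra K V}
    (h : ∀ p ∈ (coeff x).support, (p.length : ℤ) = i) (j : ℕ) :
    component j x = if (j : ℤ) = i then x else 0 := by
  split_ifs with hij
  · exact component_of_isHomogeneous fun p hp => by have := h p hp; omega
  · ext p
    rw [coeff_component]
    split_ifs with hp
    · exact Finsupp.notMem_support_iff.1 fun h' => hij (by rw [← h p h', hp])
    · rfl

theorem isInternal_agsGr (hlt : IsAdmissibleOrder lt) (hI : IsGradedIdeal I) (n : ℕ) :
    DirectSum.IsInternal (agsGr lt I n) := by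
  classical
  have hA := isGradedIdeal_agsIdeal hlt hI n
  constructor
  · rw [injective_iff_map_eq_zero]
    intro f hf
    rw [DirectSum.coeAddMonoidHom_eq_dfinsuppSum] at hf
    have hex : ∀ i : ℤ, ∃ x : PathAlgebra K V, ∃ hx : x ∈ agsIdeal lt I n,
        (∀ p ∈ (coeff x).support, (p.length : ℤ) = i) ∧
          agsMk x hx = (f i : AGSModule lt I n) := fun i => (f i).2
    choose y hy hyi hyf using hex
    have hsum : ∑ i ∈ DFinsupp.support f, y i ∈ I * agsIdeal lt I n := by
      rw [← agsMk_eq_zero (hx := Submodule.sum_mem _ fun i _ => hy i), agsMk_sum _ _ hy, ← hf]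
      exact Finset.sum_congr rfl fun i _ => hyf i
    refine DFinsupp.ext fun j => Subtype.ext ?_
    by_cases hj : j ∈ DFinsupp.support f
    · by_cases hj0 : ∃ k : ℕ, (k : ℤ) = j
      · obtain ⟨k, hk⟩ := hj0
        -- The sum of the representatives lies in the graded left ideal `I A^n`, hence so does its
        -- component of degree `j`, which is `y j`.
        have hc := hI.mul hA _ hsum k
        rw [map_sum, Finset.sum_eq_single j, component_of_forall_length (hyi j), if_pos hk] at hc
        · rw [← hyf j, agsMk_eq_zero.2 hc]; rfl
        · intro i _ hij
          rw [component_of_forall_length (hyi i), if_neg]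
          rintro rfl
          exact hij hk
        · exact fun h => absurd hj h
      · have h0 : y j = 0 := by
          by_contra hne
          obtain ⟨p, hp⟩ := Finsupp.support_nonempty_iff.2 (mt coeff_eq_zero.1 hne)
          exact hj0 ⟨_, hyi j p hp⟩
        rw [← hyf j]
        exact agsMk_eq_zero.2 (h0 ▸ Submodule.zero_mem _)
    · rw [DFinsupp.notMem_support_iff.1 hj]; rfl
  · intro m
    obtain ⟨x, hx, rfl⟩ := exists_agsMk m
    obtain ⟨N, hN⟩ := exists_sum_component x
    refine ⟨∑ k ∈ Finset.range N, DirectSum.of (fun i => agsGr lt I n i) (k : ℤ)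
      ⟨agsMk (component k x) (hA x hx k), component k x, hA x hx k, fun p hp => by
        rw [isHomogeneous_component k x p hp], rfl⟩, ?_⟩
    rw [map_sum]
    simp only [DirectSum.coeAddMonoidHom_of]
    rw [← agsMk_sum _ _ (fun k => hA x hx k)]
    exact agsMk_eq_agsMk.2 (by rw [hN, sub_self]; exact Submodule.zero_mem _)

variable [I.IsTwoSided]

theorem mk_smul_agsMk {n : ℕ} (r : PathAlgebra K V) {x : PathAlgebra K V}
    (hx : x ∈ agsIdeal lt I n) :
    Ideal.Quotient.mk I r • agsMk x hx = agsMk (r * x) (Ideal.mul_mem_left _ r hx) := rfl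

theorem agsDifferential_agsMk {n : ℕ} {x : PathAlgebra K V} (hx : x ∈ agsIdeal lt I (n + 1)) :
    agsDifferential lt I n (agsMk x hx) = agsMk x (agsIdeal_succ_le lt I n hx) := rfl

theorem isGradedModule_agsGr (hlt : IsAdmissibleOrder lt) (hI : IsGradedIdeal I) (n : ℕ) :
    IsGradedModule I (AGSModule lt I n) (agsGr lt I n) where
  isInternal := isInternal_agsGr hlt hI n
  smul_mem := by
    rintro m r hr i _ ⟨x, hx, hxi, rfl⟩
    refine ⟨r * x, Ideal.mul_mem_left _ r hx, fun p hp => ?_, (mk_smul_agsMk r hx).symm⟩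
    obtain ⟨a, ha, b, hb, hab⟩ := mem_support_mul hp
    rw [(QPath.concat_eq_some hab).2.2.2, Nat.cast_add, hr a ha, hxi b hb]

theorem agsDifferential_mem_agsGr {n : ℕ} {i : ℤ} {m : AGSModule lt I (n + 1)}
    (hm : m ∈ agsGr lt I (n + 1) i) : agsDifferential lt I n m ∈ agsGr lt I n i := by
  obtain ⟨x, hx, hxi, rfl⟩ := hm
  exact ⟨x, agsIdeal_succ_le lt I n hx, hxi, rfl⟩

theorem projective_agsModule (hlt : IsAdmissibleOrder lt) (n : ℕ) :
    Module.Projective (PathAlgebra K V ⧸ I) (AGSModule lt I n) :=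
  have : Module.Projective (PathAlgebra K V) (agsIdeal lt I n) :=
    (isTipBasis_agsSet hlt n).projective hlt
  projective_quotient_smul_top _

/-- The kernel consists of the classes of elements of `A^(n+1) ∩ I A^n = N^(n+2)`, and `N^(n+2) =
A^(n+2) + I A^(n+1)`, where the last summand is `0` in `Q^(n+1)`. -/
theorem exact_agsDifferential (hlt : IsAdmissibleOrder lt) (n : ℕ) :
    Function.Exact (agsDifferential lt I (n + 1)) (agsDifferential lt I n) := by
  intro m
  obtain ⟨x, hx, rfl⟩ := exists_agsMk m
  rw [agsDifferential_agsMk, agsMk_eq_zero]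
  constructor
  · intro h
    obtain ⟨y, hy, z, hz, rfl⟩ := exists_add_of_mem_agsSyzygy hlt (n := n) ⟨hx, h⟩
    refine ⟨agsMk y hy, ?_⟩
    rw [agsDifferential_agsMk, agsMk_eq_agsMk, sub_add_cancel_left]
    exact Submodule.neg_mem _ hz
  · rintro ⟨m, hm⟩
    obtain ⟨y, hy, rfl⟩ := exists_agsMk m
    rw [agsDifferential_agsMk, agsMk_eq_agsMk] at hm
    have h := Submodule.sub_mem _ (agsIdeal_le_agsSyzygy n hy).2
      ((mul_agsIdeal_le_agsSyzygy n hm).2)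
    rwa [sub_sub_cancel] at h

/-- This moves questions about `(J / I) Q^n` to left ideals of the path algebra, where tips and
homogeneous components can be used. -/
theorem mem_radical_smul_top {n : ℕ} {m : AGSModule lt I n} :
    m ∈ radical I • (⊤ : Submodule (PathAlgebra K V ⧸ I) (AGSModule lt I n)) ↔
      ∃ (x : PathAlgebra K V) (hx : x ∈ agsIdeal lt I n),
        x ∈ lengthGE K V 1 * agsIdeal lt I n ∧ agsMk x hx = m := by
  constructor
  · intro h
    refine Submodule.smul_induction_on h (fun r hr m _ => ?_) ?_
    · obtain ⟨r, hrJ, rfl⟩ := (Ideal.mem_map_iff_of_surjective _ Ideal.Quotient.mk_surjective).1 hr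
      obtain ⟨x, hx, rfl⟩ := exists_agsMk m
      rw [arrowIdeal_eq] at hrJ
      exact ⟨r * x, Ideal.mul_mem_left _ r hx, Ideal.mul_mem_mul hrJ hx, rfl⟩
    · rintro _ _ ⟨x, hx, hx', rfl⟩ ⟨y, hy, hy', rfl⟩
      exact ⟨x + y, Submodule.add_mem _ hx hy, Submodule.add_mem _ hx' hy', rfl⟩
  · rintro ⟨x, hx, hx', rfl⟩
    -- The membership proof is part of the claim because the class of an element is only defined
    -- with one, and the induction varies the element.
    have key : ∃ hx : x ∈ agsIdeal lt I n, agsMk x hx ∈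
        radical I • (⊤ : Submodule (PathAlgebra K V ⧸ I) (AGSModule lt I n)) := by
      refine Submodule.smul_induction_on hx' (fun r hr y hy => ?_) ?_
      · refine ⟨Ideal.mul_mem_left _ r hy, ?_⟩
        rw [← arrowIdeal_eq] at hr
        exact Submodule.smul_mem_smul (Ideal.mem_map_of_mem _ hr)
          (Submodule.mem_top (x := agsMk y hy))
      · rintro y z ⟨hy, hy'⟩ ⟨hz, hz'⟩
        exact ⟨Submodule.add_mem _ hy hz, Submodule.add_mem _ hy' hz'⟩
    exact key.2

variable (lt I) in
/-- The augmentation `Q^0 → Λ_0`. -/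
def agsAugmentation : AGSModule lt I 0 →ₗ[PathAlgebra K V ⧸ I] LambdaZero I :=
  (Submodule.liftQ (I • (⊤ : Submodule (PathAlgebra K V) (agsIdeal lt I 0)))
    (((radical I).mkQ.restrictScalars (PathAlgebra K V)) ∘ₗ
      (Submodule.mkQ I) ∘ₗ (agsIdeal lt I 0).subtype) (Submodule.smul_le.2 fun r hr x _ => by
        rw [LinearMap.mem_ker]
        have h : (Submodule.mkQ I) (r * (x : PathAlgebra K V)) = 0 :=
          (Submodule.Quotient.mk_eq_zero _).2 (I.mul_mem_right _ hr)
        change (radical I).mkQ ((Submodule.mkQ I) (r * (x : PathAlgebra K V))) = 0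
        rw [h, map_zero])).extendQuotient

theorem agsAugmentation_agsMk {x : PathAlgebra K V} (hx : x ∈ agsIdeal lt I 0) :
    agsAugmentation lt I (agsMk x hx) = (radical I).mkQ (Ideal.Quotient.mk I x) := rfl

theorem agsAugmentation_surjective : Function.Surjective (agsAugmentation lt I) := by
  intro y
  obtain ⟨y, rfl⟩ := Submodule.Quotient.mk_surjective _ y
  obtain ⟨x, rfl⟩ := Ideal.Quotient.mk_surjective y
  exact ⟨agsMk x (agsIdeal_zero.ge trivial), rfl⟩

theorem agsAugmentation_agsMk_eq_zero (hI : I ≤ lengthGE K V 1) {x : PathAlgebra K V}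
    (hx : x ∈ agsIdeal lt I 0) :
    agsAugmentation lt I (agsMk x hx) = 0 ↔ x ∈ lengthGE K V 1 := by
  rw [agsAugmentation_agsMk, Submodule.mkQ_apply, Submodule.Quotient.mk_eq_zero, radical,
    Ideal.mem_map_iff_of_surjective _ Ideal.Quotient.mk_surjective, arrowIdeal_eq]
  constructor
  · rintro ⟨y, hy, hyx⟩
    have h := Submodule.sub_mem _ hy (hI (Ideal.Quotient.eq.1 hyx))
    rwa [sub_sub_cancel] at h
  · exact fun h => ⟨x, h, rfl⟩

theorem exact_agsAugmentation (hI : I ≤ lengthGE K V 1) :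
    Function.Exact (agsDifferential lt I 0) (agsAugmentation lt I) := by
  intro m
  obtain ⟨x, hx, rfl⟩ := exists_agsMk m
  rw [agsAugmentation_agsMk_eq_zero hI]
  constructor
  · exact fun h => ⟨agsMk x (agsIdeal_one.ge h), rfl⟩
  · rintro ⟨m, hm⟩
    obtain ⟨y, hy, rfl⟩ := exists_agsMk m
    rw [agsDifferential_agsMk, agsMk_eq_agsMk] at hm
    have h := Submodule.sub_mem _ (agsIdeal_one.le hy) (hI (mul_agsIdeal_zero_le hm))
    rwa [sub_sub_cancel] at h

theorem agsAugmentation_eq_zero_of_mem_agsGr (hI : I ≤ lengthGE K V 1) {i : ℤ} (hi : i ≠ 0)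
    {m : AGSModule lt I 0} (hm : m ∈ agsGr lt I 0 i) : agsAugmentation lt I m = 0 := by
  obtain ⟨x, hx, hxi, rfl⟩ := hm
  rw [agsAugmentation_agsMk_eq_zero hI]
  intro p hp
  have := hxi p hp
  omega

/-- The AGS resolution is a graded projective resolution. -/
def agsResolution (hlt : IsAdmissibleOrder lt) (hI : IsGradedIdeal I) (hI₁ : I ≤ lengthGE K V 1)
    (hmin : AGSIsMinimal lt I) : MinimalGradedResolution I where
  P := AGSModule lt I
  gr := agsGr lt I
  graded := isGradedModule_agsGr hlt hI
  projective := projective_agsModule hlt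
  d := agsDifferential lt I
  ε := agsAugmentation lt I
  d_degree _ _ _ := agsDifferential_mem_agsGr
  ε_degree _ hi _ := agsAugmentation_eq_zero_of_mem_agsGr hI₁ hi
  ε_surjective := agsAugmentation_surjective
  exact_zero := exact_agsAugmentation hI₁
  exact_succ := exact_agsDifferential hlt
  minimal := hmin

theorem agsIsMinimal_of_isMonomialIdeal (hlt : IsAdmissibleOrder lt) (hI : I ≤ lengthGE K V 2)
    (hm : IsMonomialIdeal I) : AGSIsMinimal lt I := by
  rintro n _ ⟨m, rfl⟩
  obtain ⟨x, hx, rfl⟩ := exists_agsMk m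
  exact mem_radical_smul_top.2
    ⟨x, agsIdeal_succ_le lt I n hx, agsIdeal_succ_le_lengthGE_mul hlt hI hm n hx, rfl⟩

theorem span_agsGr_eq_top {n d : ℕ} (h : ∀ x ∈ agsSet lt I n, IsHomogeneousOfDegree d x) :
    Submodule.span (PathAlgebra K V ⧸ I) (agsGr lt I n d : Set (AGSModule lt I n)) = ⊤ := by
  rw [eq_top_iff]
  rintro m -
  obtain ⟨x, hx, rfl⟩ := exists_agsMk m
  have key : ∃ hx : x ∈ agsIdeal lt I n, agsMk x hx ∈
      Submodule.span (PathAlgebra K V ⧸ I) (agsGr lt I n d : Set (AGSModule lt I n)) := by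
    refine Submodule.span_induction (p := fun x _ => ∃ hx : x ∈ agsIdeal lt I n, agsMk x hx ∈
      Submodule.span (PathAlgebra K V ⧸ I) (agsGr lt I n d : Set (AGSModule lt I n)))
      (fun s hs => ?_) ?_ ?_ ?_ hx
    · exact ⟨Ideal.subset_span hs, Submodule.subset_span
        ⟨s, Ideal.subset_span hs, fun p hp => by rw [h s hs p hp], rfl⟩⟩
    · exact ⟨Submodule.zero_mem _, Submodule.zero_mem _⟩
    · rintro y z - - ⟨hy, hy'⟩ ⟨hz, hz'⟩
      exact ⟨Submodule.add_mem _ hy hz, Submodule.add_mem _ hy' hz'⟩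
    · rintro c y - ⟨hy, hy'⟩
      exact ⟨Ideal.mul_mem_left _ c hy, Submodule.smul_mem _ (Ideal.Quotient.mk I c) hy'⟩
  exact key.2

/-- If `Q^n` is generated by its component of degree `d` modulo `J Q^n`, then the elements of `f^n`
are homogeneous of degree `d`. -/
theorem isHomogeneousOfDegree_of_le_sup (hlt : IsAdmissibleOrder lt) (hI : IsGradedIdeal I)
    (hI₁ : I ≤ lengthGE K V 1) {n d : ℕ}
    (h : ⊤ ≤ Submodule.span (PathAlgebra K V ⧸ I) (agsGr lt I n d : Set (AGSModule lt I n)) ⊔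
      radical I • (⊤ : Submodule (PathAlgebra K V ⧸ I) (AGSModule lt I n)))
    {x : PathAlgebra K V} (hx : x ∈ agsSet lt I n) : IsHomogeneousOfDegree d x := by
  have hA := isGradedIdeal_agsIdeal hlt hI n
  have hJA := (isGradedIdeal_lengthGE (K := K) (V := V) 1).mul hA
  have hIJ : I * agsIdeal lt I n ≤ lengthGE K V 1 * agsIdeal lt I n :=
    Submodule.smul_mono_left hI₁
  obtain ⟨e, he⟩ := isHomogeneous_of_mem_agsSet hlt hI n x hx
  by_cases hed : e = d
  · rwa [← hed]
  exfalso
  -- For `e ≠ d`, submodule elements generated in degree `d` have representatives with degree-`e`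
  -- component in `J A^n`.
  have hcomp : ∀ m ∈ Submodule.span (PathAlgebra K V ⧸ I)
      (agsGr lt I n d : Set (AGSModule lt I n)), ∃ (y : PathAlgebra K V)
        (hy : y ∈ agsIdeal lt I n), component e y ∈ lengthGE K V 1 * agsIdeal lt I n ∧
          agsMk y hy = m := by
    intro m hm
    refine Submodule.span_induction (p := fun m _ => ∃ (y : PathAlgebra K V)
        (hy : y ∈ agsIdeal lt I n), component e y ∈ lengthGE K V 1 * agsIdeal lt I n ∧
          agsMk y hy = m) ?_ ?_ ?_ ?_ hm
    · rintro _ ⟨y, hy, hyd, rfl⟩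
      refine ⟨y, hy, ?_, rfl⟩
      rw [component_of_isHomogeneous_ne (n := d) (fun p hp => Nat.cast_injective (hyd p hp))
        (Ne.symm hed)]
      exact Submodule.zero_mem _
    · exact ⟨0, Submodule.zero_mem _, by rw [map_zero]; exact Submodule.zero_mem _, rfl⟩
    · rintro _ _ - - ⟨y, hy, hy', rfl⟩ ⟨z, hz, hz', rfl⟩
      exact ⟨y + z, Submodule.add_mem _ hy hz, by
        rw [map_add]; exact Submodule.add_mem _ hy' hz', rfl⟩
    · rintro c _ - ⟨y, hy, hy', rfl⟩
      obtain ⟨r, rfl⟩ := Ideal.Quotient.mk_surjective c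
      refine ⟨r * y, Ideal.mul_mem_left _ r hy, ?_, rfl⟩
      rw [component_mul]
      refine Ideal.sum_mem _ ?_
      rintro ⟨k, l⟩ hkl
      -- A coefficient of degree `0` preserves the degree-`e` component of `y`; one of positive
      -- degree lies in `J`.
      rcases Nat.eq_zero_or_pos k with rfl | hk
      · obtain rfl : l = e := by simpa using hkl
        exact Ideal.mul_mem_left _ _ hy'
      · exact Ideal.mul_mem_mul
          (fun p hp => by rw [(mem_support_component.1 hp).1]; exact hk) (hA y hy l)
  have hxA : x ∈ agsIdeal lt I n := Ideal.subset_span hx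
  obtain ⟨m₁, h₁, m₂, h₂, hm⟩ := Submodule.mem_sup.1
    (h (Submodule.mem_top (x := agsMk x hxA)))
  obtain ⟨y, hy, hy', rfl⟩ := hcomp m₁ h₁
  obtain ⟨z, hz, hz', rfl⟩ := mem_radical_smul_top.1 h₂
  rw [← agsMk_add, agsMk_eq_agsMk] at hm
  refine notMem_lengthGE_mul_agsIdeal hlt hx ?_
  -- The component of degree `e` of `x` is `x` itself, so comparing components puts `x` in `J A^n`.
  have hc := hJA _ (hIJ hm) e
  rw [map_sub, map_add, component_of_isHomogeneous he] at hc
  have := Submodule.sub_mem _ (Submodule.add_mem _ hy' (hJA z hz' e)) hc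
  rwa [sub_sub_cancel] at this

end agsModule

end PathAlgebra

namespace PathAlgebra

/-! ### Projections onto components and lifts of degree `0`. -/

section gradedModules

variable {K : Type w} [Field K] {V : Type u} [Quiver.{v} V] [Fintype V]
  {I : Ideal (PathAlgebra K V)} [I.IsTwoSided]
  {M : Type*} [AddCommGroup M] [Module (PathAlgebra K V ⧸ I) M] {gr : ℤ → AddSubgroup M}

namespace IsGradedModule

/-- The decomposition into homogeneous components. -/
@[reducible]
def decomposition (h : IsGradedModule I M gr) : DirectSum.Decomposition gr :=
  h.isInternal.chooseDecomposition

/-- The projection onto a homogeneous component. -/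
def proj (h : IsGradedModule I M gr) (i : ℤ) : M →+ M :=
  letI := h.decomposition
  (gr i).subtype.comp ((DFinsupp.evalAddMonoidHom i).comp
    (DirectSum.decomposeAddEquiv gr).toAddMonoidHom)

theorem proj_mem (h : IsGradedModule I M gr) (i : ℤ) (x : M) : h.proj i x ∈ gr i :=
  SetLike.coe_mem _

theorem proj_of_mem (h : IsGradedModule I M gr) {i : ℤ} {x : M} (hx : x ∈ gr i) :
    h.proj i x = x := by
  let := h.decomposition
  exact DirectSum.decompose_of_mem_same gr hx

theorem proj_of_mem_ne (h : IsGradedModule I M gr) {i j : ℤ} {x : M} (hx : x ∈ gr i)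
    (hij : i ≠ j) : h.proj j x = 0 := by
  let := h.decomposition
  exact DirectSum.decompose_of_mem_ne gr hx hij

theorem induction_on (h : IsGradedModule I M gr) {motive : M → Prop} (x : M)
    (mem : ∀ i, ∀ x ∈ gr i, motive x) (add : ∀ x y, motive x → motive y → motive (x + y)) :
    motive x := by
  let := h.decomposition
  exact DirectSum.Decomposition.inductionOn gr (mem 0 0 (gr 0).zero_mem)
    (fun m => mem _ _ m.2) add x

theorem proj_smul (h : IsGradedModule I M gr) {n : ℕ} {r : PathAlgebra K V}
    (hr : IsHomogeneousOfDegree n r) (i : ℤ) (x : M) :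
    h.proj (n + i) (Ideal.Quotient.mk I r • x) = Ideal.Quotient.mk I r • h.proj i x := by
  refine h.induction_on (motive := fun x => h.proj (n + i) (Ideal.Quotient.mk I r • x) =
    Ideal.Quotient.mk I r • h.proj i x) x (fun j x hx => ?_) fun x y hx hy => ?_
  · have hrx := h.smul_mem n r hr j x hx
    by_cases hij : j = i
    · subst hij
      rw [h.proj_of_mem hrx, h.proj_of_mem hx]
    · rw [h.proj_of_mem_ne hrx (by omega), h.proj_of_mem_ne hx hij, smul_zero]
  · rw [smul_add, map_add, map_add, smul_add, hx, hy]

variable {P Q N : Type*} [AddCommGroup P] [Module (PathAlgebra K V ⧸ I) P]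
  [AddCommGroup Q] [Module (PathAlgebra K V ⧸ I) Q]
  [AddCommGroup N] [Module (PathAlgebra K V ⧸ I) N]
  {grP : ℤ → AddSubgroup P} {grQ : ℤ → AddSubgroup Q}

/-- The homogeneous component of degree `0` of a linear map. -/
theorem exists_degree_zero_part (hP : IsGradedModule I P grP) (hQ : IsGradedModule I Q grQ)
    (f : P →ₗ[PathAlgebra K V ⧸ I] Q) : ∃ g : P →ₗ[PathAlgebra K V ⧸ I] Q,
      ∀ i, ∀ x ∈ grP i, g x = hQ.proj i (f x) := by
  let := hP.decomposition
  let g : P →+ Q := (DirectSum.toAddMonoid fun i =>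
    (hQ.proj i).comp (f.toAddMonoidHom.comp (grP i).subtype)).comp
      (DirectSum.decomposeAddEquiv grP).toAddMonoidHom
  have hg : ∀ i, ∀ x ∈ grP i, g x = hQ.proj i (f x) := by
    intro i x hx
    change DirectSum.toAddMonoid _ (DirectSum.decompose grP x) = _
    rw [DirectSum.decompose_of_mem grP hx, DirectSum.toAddMonoid_of]
    rfl
  refine ⟨{ g with map_smul' := fun r x => ?_ }, hg⟩
  obtain ⟨r, rfl⟩ := Ideal.Quotient.mk_surjective r
  change g (Ideal.Quotient.mk I r • x) = Ideal.Quotient.mk I r • g x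
  refine hP.induction_on (motive := fun x => g (Ideal.Quotient.mk I r • x) =
    Ideal.Quotient.mk I r • g x) x (fun i x hx => ?_) fun x y hx hy => ?_
  · obtain ⟨n, hn⟩ := exists_sum_component r
    rw [← hn, map_sum, Finset.sum_smul, Finset.sum_smul, map_sum]
    refine Finset.sum_congr rfl fun k _ => ?_
    have hk := isHomogeneous_component k r
    rw [hg _ _ (hP.smul_mem k _ hk i x hx), map_smul, hQ.proj_smul hk, hg i x hx]
  · rw [smul_add, map_add, map_add, smul_add, hx, hy]

/-- Take the degree-`0` part of any lift. The hypothesis `hc` says that it is still a lift; `N`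
itself carries no grading here, so that the augmentation and the differentials are both covered. -/
theorem exists_graded_lift (hP : IsGradedModule I P grP) (hQ : IsGradedModule I Q grQ)
    [Module.Projective (PathAlgebra K V ⧸ I) P]
    (f : Q →ₗ[PathAlgebra K V ⧸ I] N) (g : P →ₗ[PathAlgebra K V ⧸ I] N)
    (hr : ∀ x, g x ∈ LinearMap.range f)
    (hc : ∀ i, ∀ x ∈ grP i, ∀ y, f y = g x → f (hQ.proj i y) = g x) :
    ∃ φ : P →ₗ[PathAlgebra K V ⧸ I] Q, (∀ x, f (φ x) = g x) ∧ ∀ i, ∀ x ∈ grP i, φ x ∈ grQ i := by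
  obtain ⟨φ, hφ⟩ := Module.projective_lifting_property f.rangeRestrict
    (g.codRestrict (LinearMap.range f) hr) f.surjective_rangeRestrict
  have hφ' : ∀ x, f (φ x) = g x := fun x => congrArg Subtype.val (LinearMap.congr_fun hφ x)
  obtain ⟨ψ, hψ⟩ := exists_degree_zero_part hP hQ φ
  refine ⟨ψ, fun x => ?_, fun i x hx => by rw [hψ i x hx]; exact hQ.proj_mem i _⟩
  refine hP.induction_on (motive := fun x => f (ψ x) = g x) x (fun i x hx => ?_)
    fun x y hx hy => by rw [map_add, map_add, map_add, hx, hy]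
  rw [hψ i x hx]
  exact hc i x hx _ (hφ' x)

theorem map_proj (hQ : IsGradedModule I Q grQ) (hM : IsGradedModule I M gr)
    (f : Q →ₗ[PathAlgebra K V ⧸ I] M) (hf : ∀ i, ∀ x ∈ grQ i, f x ∈ gr i) (i : ℤ) (x : Q) :
    f (hQ.proj i x) = hM.proj i (f x) := by
  refine hQ.induction_on (motive := fun x => f (hQ.proj i x) = hM.proj i (f x)) x
    (fun j x hx => ?_) fun x y hx hy => by rw [map_add, map_add, map_add, map_add, hx, hy]
  by_cases hij : j = i
  · subst hij
    rw [hQ.proj_of_mem hx, hM.proj_of_mem (hf j x hx)]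
  · rw [hQ.proj_of_mem_ne hx hij, hM.proj_of_mem_ne (hf j x hx) hij, map_zero]

end IsGradedModule

end gradedModules

end PathAlgebra

/-! ### Comparison of minimal resolutions. -/

section comparison

variable {Λ : Type*} [Ring Λ] {P P' Q Q' Q'' : Type*}
  [AddCommGroup P] [AddCommGroup P'] [AddCommGroup Q] [AddCommGroup Q'] [AddCommGroup Q'']
  [Module Λ P] [Module Λ P'] [Module Λ Q] [Module Λ Q'] [Module Λ Q'']

theorem exists_lift_of_forall_mem_range [Module.Projective Λ P] (f : Q →ₗ[Λ] Q') (g : P →ₗ[Λ] Q')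
    (hr : ∀ x, g x ∈ LinearMap.range f) : ∃ h : P →ₗ[Λ] Q, ∀ x, f (h x) = g x := by
  obtain ⟨h, hh⟩ := Module.projective_lifting_property f.rangeRestrict
    (g.codRestrict (LinearMap.range f) hr) f.surjective_rangeRestrict
  exact ⟨h, fun x => congrArg Subtype.val (LinearMap.congr_fun hh x)⟩

/-- One step of the construction of a homotopy inverse `ψ` of a chain map `φ` and of a homotopy `h`
from `φ ψ` to the identity. -/
theorem exists_homotopy_step [Module.Projective Λ Q'] {ZP : Submodule Λ P} {ZQ : Submodule Λ Q}
    {φ : P →ₗ[Λ] Q} {ψ : Q →ₗ[Λ] P} {h : Q →ₗ[Λ] Q'} {φ' : P' →ₗ[Λ] Q'}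
    {dP : P' →ₗ[Λ] P} {dQ : Q' →ₗ[Λ] Q} {dQ' : Q'' →ₗ[Λ] Q'}
    (hdP : LinearMap.range dP = ZP) (hdQ : LinearMap.range dQ = ZQ)
    (hdQ' : LinearMap.range dQ' = LinearMap.ker dQ)
    (hψ : ∀ q ∈ ZQ, ψ q ∈ ZP) (hh : ∀ q ∈ ZQ, φ (ψ q) - q = dQ (h q))
    (hφ : ∀ p, dQ (φ' p) = φ (dP p)) :
    ∃ (ψ' : Q' →ₗ[Λ] P') (h' : Q' →ₗ[Λ] Q''), (∀ q, dP (ψ' q) = ψ (dQ q)) ∧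
      ∀ q, φ' (ψ' q) - q = dQ' (h' q) + h (dQ q) := by
  have hZ : ∀ q, dQ q ∈ ZQ := fun q => hdQ ▸ LinearMap.mem_range_self dQ q
  obtain ⟨ψ', hψ'⟩ := exists_lift_of_forall_mem_range dP (ψ ∘ₗ dQ)
    fun q => hdP ▸ hψ _ (hZ q)
  -- The defect `φ' ψ' - 1 - h dQ` is killed by `dQ`, by the homotopy relation on `ZQ` one degree
  -- lower, so it lifts through `dQ'`.
  obtain ⟨h', hh'⟩ := exists_lift_of_forall_mem_range dQ' (φ' ∘ₗ ψ' - LinearMap.id - h ∘ₗ dQ)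
    fun q => by
      have h₁ := hψ' q
      rw [LinearMap.comp_apply] at h₁
      rw [hdQ', LinearMap.mem_ker]
      simp only [LinearMap.sub_apply, LinearMap.comp_apply, LinearMap.id_apply, map_sub]
      rw [hφ, h₁, ← hh _ (hZ q), sub_self]
  refine ⟨ψ', h', hψ', fun q => ?_⟩
  rw [hh']
  simp

end comparison

namespace PathAlgebra

namespace MinimalGradedResolution

variable {K : Type w} [Field K] {V : Type u} [Quiver.{v} V] [Fintype V]
  {I : Ideal (PathAlgebra K V)} [I.IsTwoSided]

/-- The kernel of the map which starts at `P n`. -/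
def cycles (R : MinimalGradedResolution I) : ∀ n, Submodule (PathAlgebra K V ⧸ I) (R.P n)
  | 0 => LinearMap.ker R.ε
  | n + 1 => LinearMap.ker (R.d n)

theorem range_d (R : MinimalGradedResolution I) :
    ∀ n, LinearMap.range (R.d n) = R.cycles n
  | 0 => R.exact_zero.linearMap_ker_eq.symm
  | n + 1 => (R.exact_succ n).linearMap_ker_eq.symm

/-- The relation between `φ ψ` and the identity is recorded on cycles only, where the term `h d`
vanishes; that is all the next step needs. Both homotopy terms take values in the radical times `S.P
n`, by minimality of `S`, so `φ` is surjective modulo the radical. Only `φ` has to preserve degrees.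
-/
theorem exists_homotopy (R S : MinimalGradedResolution I) (n : ℕ) :
    ∃ (φ : R.P n →ₗ[PathAlgebra K V ⧸ I] S.P n) (ψ : S.P n →ₗ[PathAlgebra K V ⧸ I] R.P n)
      (h : S.P n →ₗ[PathAlgebra K V ⧸ I] S.P (n + 1)),
      (∀ i, ∀ x ∈ R.gr n i, φ x ∈ S.gr n i) ∧ (∀ p ∈ R.cycles n, φ p ∈ S.cycles n) ∧
      (∀ q ∈ S.cycles n, ψ q ∈ R.cycles n) ∧ (∀ q ∈ S.cycles n, φ (ψ q) - q = S.d n (h q)) ∧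
      (⊤ ≤ LinearMap.range φ ⊔
        radical I • (⊤ : Submodule (PathAlgebra K V ⧸ I) (S.P n))) := by
  have aux : ∀ (m : ℕ) (y : S.P (m + 1)), S.d m y ∈ radical I • (⊤ : Submodule _ (S.P m)) :=
    fun m y => S.minimal m (LinearMap.mem_range_self _ y)
  induction n with
  | zero =>
    have := R.projective 0
    have := S.projective 0
    obtain ⟨φ, hφ, hgr⟩ := (R.graded 0).exists_graded_lift (S.graded 0) S.ε R.ε
      (fun x => S.ε_surjective _) fun i x hx y hy => by
        by_cases hi : i = 0
        · subst hi
          rw [← hy]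
          refine (S.graded 0).induction_on
            (motive := fun y => S.ε ((S.graded 0).proj 0 y) = S.ε y) y
            (fun j y hj => ?_) fun y z hy hz => by rw [map_add, map_add, map_add, hy, hz]
          by_cases hj0 : j = 0
          · subst hj0; rw [(S.graded 0).proj_of_mem hj]
          · rw [(S.graded 0).proj_of_mem_ne hj hj0, map_zero, S.ε_degree j hj0 y hj]
        · rw [R.ε_degree i hi x hx, S.ε_degree i hi _ ((S.graded 0).proj_mem i y)]
    -- The induction starts one place to the left, at `Λ_0` with identity maps and zero homotopy,
    -- all elements counting as cycles.
    obtain ⟨ψ, h, hψ, hh⟩ := exists_homotopy_step (ZP := ⊤) (ZQ := ⊤) (φ := LinearMap.id)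
      (ψ := LinearMap.id) (h := 0) (φ' := φ) (dP := R.ε) (dQ := S.ε) (dQ' := S.d 0)
      (LinearMap.range_eq_top.2 R.ε_surjective) (LinearMap.range_eq_top.2 S.ε_surjective)
      (S.range_d 0) (fun _ _ => trivial) (fun q _ => by simp) (fun p => hφ p)
    have hh₀ : ∀ q, φ (ψ q) - q = S.d 0 (h q) := fun q => by rw [hh q]; simp
    refine ⟨φ, ψ, h, hgr, fun p hp => ?_, fun q hq => ?_, fun q _ => hh₀ q, fun q _ => ?_⟩
    · exact LinearMap.mem_ker.2 ((hφ p).trans (LinearMap.mem_ker.1 hp))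
    · exact LinearMap.mem_ker.2 ((hψ q).trans (LinearMap.mem_ker.1 hq))
    · rw [← sub_sub_cancel (φ (ψ q)) q, hh₀ q]
      exact Submodule.sub_mem _ (Submodule.mem_sup_left (LinearMap.mem_range_self φ _))
        (Submodule.mem_sup_right (aux 0 _))
  | succ n ih =>
    obtain ⟨φ, ψ, h, hgr, hφZ, hψZ, hh, -⟩ := ih
    have := R.projective (n + 1)
    have := S.projective (n + 1)
    obtain ⟨φ', hφ', hgr'⟩ := (R.graded (n + 1)).exists_graded_lift (S.graded (n + 1)) (S.d n)
      (φ ∘ₗ R.d n) (fun x => by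
        rw [S.range_d]
        refine hφZ _ ?_
        rw [← R.range_d]
        exact LinearMap.mem_range_self _ x) fun i x hx y hy => by
        rw [(S.graded (n + 1)).map_proj (S.graded n) (S.d n) (fun i x => S.d_degree n i x), hy]
        exact (S.graded n).proj_of_mem (hgr i _ (R.d_degree n i x hx))
    obtain ⟨ψ', h', hψ', hh'⟩ := exists_homotopy_step (φ' := φ') (R.range_d n) (S.range_d n)
      (S.range_d (n + 1)) hψZ hh hφ'
    refine ⟨φ', ψ', h', hgr', fun p hp => ?_, fun q hq => ?_, fun q hq => ?_, fun q _ => ?_⟩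
    · have hp' : R.d n p = 0 := LinearMap.mem_ker.1 hp
      refine LinearMap.mem_ker.2 ?_
      rw [hφ', LinearMap.comp_apply, hp', map_zero]
    · have hq' : S.d n q = 0 := LinearMap.mem_ker.1 hq
      refine LinearMap.mem_ker.2 ?_
      rw [hψ', hq', map_zero]
    · have hq' : S.d n q = 0 := LinearMap.mem_ker.1 hq
      rw [hh', hq', map_zero, add_zero]
    · rw [← sub_sub_cancel (φ' (ψ' q)) q, hh' q]
      refine Submodule.sub_mem _ (Submodule.mem_sup_left (LinearMap.mem_range_self φ' _))
        (Submodule.mem_sup_right (Submodule.add_mem _ (aux (n + 1) _) ?_))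
      -- The term `h d` is in the radical part because `d` is, by minimality, and `h` is linear.
      have hm : h (S.d n q) ∈ (radical I • (⊤ : Submodule (PathAlgebra K V ⧸ I) (S.P n))).map h :=
        Submodule.mem_map_of_mem (aux n q)
      rw [Submodule.map_smul''] at hm
      exact Submodule.smul_mono le_rfl le_top hm

/-- If the modules of one minimal resolution can be generated in degrees `F n`, then so can those
of any other one, modulo the radical. -/
theorem top_le_span_sup (R S : MinimalGradedResolution I) {n : ℕ} {i : ℤ}
    (hR : Submodule.span (PathAlgebra K V ⧸ I) (R.gr n i : Set (R.P n)) = ⊤) :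
    ⊤ ≤ Submodule.span (PathAlgebra K V ⧸ I) (S.gr n i : Set (S.P n)) ⊔
      radical I • (⊤ : Submodule (PathAlgebra K V ⧸ I) (S.P n)) := by
  obtain ⟨φ, -, -, hgr, -, -, -, h⟩ := exists_homotopy R S n
  refine h.trans (sup_le_sup_right ?_ _)
  rw [LinearMap.range_eq_map, ← hR, Submodule.map_span]
  refine Submodule.span_mono ?_
  rintro _ ⟨x, hx, rfl⟩
  exact hgr i x hx

end MinimalGradedResolution

/-! ### Transfer of the generating degrees to the monomial algebra. -/

theorem isFDetermined_tipIdeal {K : Type w} [Field K] {V : Type u} [Quiver.{v} V] [Fintype V]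
    {I : Ideal (PathAlgebra K V)} [I.IsTwoSided] {lt : QPath V → QPath V → Prop}
    (hlt : IsAdmissibleOrder lt) (hI : IsGradedIdeal I) (hI₂ : I ≤ lengthGE K V 2) {F : ℕ → ℕ}
    (hF : IsFDetermined I F) (hmin : AGSIsMinimal lt I) :
    IsFDetermined (tipIdeal hlt I) F := by
  obtain ⟨R, hR⟩ := hF
  have hI₁ := hI₂.trans (lengthGE_anti one_le_two)
  have hT₂ := tipIdeal_le_lengthGE hlt hI₂
  have hT₁ := hT₂.trans (lengthGE_anti one_le_two)
  have hm := isMonomialIdeal_tipIdeal hlt I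
  refine ⟨agsResolution hlt hm.isGradedIdeal hT₁ (agsIsMinimal_of_isMonomialIdeal hlt hT₂ hm),
    fun n => span_agsGr_eq_top fun x hx => ?_⟩
  obtain ⟨p, rfl⟩ := agsSet_subset_range hm n hx
  have hp : p ∈ tips lt (agsSet lt (tipIdeal hlt I) n) := ⟨_, hx, isTip_ofPath p⟩
  -- The path `p` in the monomial `f^n` becomes the tip of some `y` in the set `f^n` of `I`, and the
  -- length of `p` is the degree of `y`.
  rw [tips_agsSet_congr hlt hT₁ hI₁ (tips_tipIdeal hlt I) n] at hp
  obtain ⟨y, hy, hyp⟩ := hp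
  have hd : p.length = F n := isHomogeneousOfDegree_of_le_sup hlt hI hI₁
    (R.top_le_span_sup (agsResolution hlt hI hI₁ hmin) (hR n)) hy p hyp.1
  exact hd ▸ isHomogeneous_ofPath p

end PathAlgebra

end

open PathAlgebra in
theorem proposition9 {K : Type w} [Field K] {V : Type u} [Quiver.{v} V] [Fintype V]
    [∀ a b : V, Finite (a ⟶ b)]
    (I : Ideal (PathAlgebra K V)) [I.IsTwoSided]
    (hI : IsHomogeneousIdeal I) (hIJ : I ≤ arrowIdeal K V * arrowIdeal K V)
    (lt : QPath V → QPath V → Prop) (hlt : IsAdmissibleOrder lt)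
    (G : Set (PathAlgebra K V)) (hG : IsReducedGroebnerBasis lt I G)
    (F : ℕ → ℕ) (hF : IsFDetermined I F) (hmin : AGSIsMinimal lt I) :
    IsFDetermined (monomialIdeal lt G) F := by
  have hI₂ : I ≤ lengthGE K V 2 := by
    refine hIJ.trans ?_
    rw [arrowIdeal_eq]
    exact lengthGE_mul_le 1 1
  have h := isFDetermined_tipIdeal hlt hI.isGradedIdeal hI₂ hF hmin
  -- The quotient ring depends on the proof of two-sidedness, so the ideal and this proof are
  -- generalised together before the equality of ideals is substituted.
  obtain ⟨N, hN, hNF⟩ : ∃ (N : Ideal (PathAlgebra K V)) (_ : N.IsTwoSided),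
    N = monomialIdeal lt G ∧ IsFDetermined N F :=
    ⟨tipIdeal hlt I, inferInstance, (monomialIdeal_eq_tipIdeal hlt hG).symm, h⟩
  obtain ⟨hN, hNF⟩ := hNF
  subst hN
  exact hNF
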